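/- Let $n\ge 1$ and $k\ge 0$ be integers (for instance $k\ll n$), let $\Sigma_k\subseteq\mathbb R^n$ be the set of vectors with at most $k$ nonzero components, put $\operatorname{sign}(t)=1$ for $t\ge 0$ and $\operatorname{sign}(t)=-1$ for $t<0$, and let $H(x)=\{a\in\mathbb R^n:\langle a,x\rangle\ge 0\}$. For a probability measure $P$ on $\mathbb R^n$ and $x,\hat x\in\mathbb R^n$ put $$J(\hat x,x)=E_{a\sim P}\,|I_{H(x)}(a)-I_{H(\hat x)}(a)|,\qquad \rho(\hat x,x)=E_{a\sim P}\,|\operatorname{sign}\langle a,\hat x\rangle-\operatorname{sign}\langle a,x\rangle| .$$ An algorithm is a sequence of arbitrary maps which, for every $m$, send $m$ pairs $(a_i,y_i)\in\mathbb R^n\times\{-1,1\}$ to an estimate $\hat x\in\mathbb R^n$. Suppose that the algorithm always outputs a vector $\hat x\in\Sigma_k$ and that it is consistent: whenever $x\in\Sigma_k$ and $y_i=\operatorname{sign}\langle a_i,x\rangle$ for $i=1,\dots,m$, its output satisfies $\operatorname{sign}\langle a_i,\hat x\rangle=y_i$ for all $i$. Then the algorithm is probably approximately correct under the family of all probability measures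 on $\mathbb R^n$: for every $\epsilon>0$, $$\sup_{P}\ \sup_{x\in\Sigma_k} P^m\{(a_1,\dots,a_m): J(\hat x,x)>\epsilon\}\longrightarrow 0\qquad(m\to\infty),$$ where $\hat x$ is the output on $(a_i,\operatorname{sign}\langle a_i,x\rangle)_{i\le m}$ and the supremum over $P$ is over all Borel probability measures on $\mathbb R^n$ (for sets that are not measurable, $P^m$ stands for the outer measure, here and below). In particular, let $P$ be any probability measure on $\mathbb R^n$, let $x\in\Sigma_k$, $\epsilon,\delta>0$, and with $\lg=\log_2$ let $$d=\lfloor 2k\lg(ne)\rfloor,\qquad m\ \ge\ \max\Big\{\frac{8d}{\epsilon}\lg\frac{8e}{\epsilon},\ \frac4\epsilon\lg\frac2\delta\Big\}.$$ If $a_1,\dots,a_m$ are drawn independently from $P$, then with confidence at least $1-\delta$ (that is, outside a set of samples of $P^m$-measure at most $\delta$) one has $J(\hat x,x)\le\epsilon$ and $\rho(\hat x,x)\le 2\epsilon$. Moreover, if $P$ is radially invariant, meaning that $a/\|a\|_2$ is uniformly distributed on the unit sphere $S^{n-1}$ when $a\sim P$, and if $\|x\|_2=1$, then with confidence at least $1-\delta$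 the following holds: if $\|\hat x\|_2=1$, then $$\|\hat x-x\|_2^2\le\frac4\alpha\,\epsilon,\qquad\text{where } \alpha=\min_{0<\theta<2\pi}\frac2\pi\,\frac{\theta}{1-\cos\theta}.$$ -/

import Mathlib

open MeasureTheory Filter Topology Set

noncomputable section

namespace OneBit

/-! ### Concept learning -/

/-- A concept class on a measurable space `X`: a collection of measurable subsets of `X`. -/
structure ConceptClass (X : Type*) [MeasurableSpace X] where
  sets : Set (Set X)
  measurableSet : ∀ T ∈ sets, MeasurableSet T

/-- A learning algorithm: for every `m`, a map that sends `m` labelled samples to a concept.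
The labels `0` and `1` are `false` and `true`.  No measurability or computability is required. -/
def Algorithm {X : Type*} [MeasurableSpace X] (C : ConceptClass X) : Type _ :=
  (m : ℕ) → (Fin m → X × Bool) → C.sets

open Classical in
/-- The samples `c`, each labelled by the value of the indicator function of `T`. -/
def labelled {X : Type*} {m : ℕ} (T : Set X) (c : Fin m → X) : Fin m → X × Bool :=
  fun i => (c i, decide (c i ∈ T))

/-- The generalization error `J(T, G) = E_P |I_T - I_G|`. -/
def genError {X : Type*} [MeasurableSpace X] (P : Measure X) (T G : Set X) : ℝ :=
  ∫ z, |T.indicator (fun _ => (1 : ℝ)) z - G.indicator (fun _ => (1 : ℝ)) z| ∂P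

/-- The joint law `P^m` of `m` independent samples drawn from `P`. -/
def sampleLaw {X : Type*} [MeasurableSpace X] (P : ProbabilityMeasure X) (m : ℕ) :
    Measure (Fin m → X) :=
  Measure.pi (fun _ => (P : Measure X))

/-- The learning rate `r(m, ε)`: the supremum, over all laws in the family `F` and all target
concepts `T`, of the (outer) probability that the hypothesis has generalization error `> ε`. -/
def learningRate {X : Type*} [MeasurableSpace X] {C : ConceptClass X}
    (F : Set (ProbabilityMeasure X)) (A : Algorithm C) (m : ℕ) (ε : ℝ) : ENNReal :=
  ⨆ P ∈ F, ⨆ T ∈ C.sets,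
    sampleLaw P m {c | ε < genError (P : Measure X) T (A m (labelled T c))}

/-- The algorithm `A` is probably approximately correct under the family `F` of laws. -/
def IsPAC {X : Type*} [MeasurableSpace X] {C : ConceptClass X}
    (F : Set (ProbabilityMeasure X)) (A : Algorithm C) : Prop :=
  ∀ ε : ℝ, 0 < ε → Tendsto (fun m => learningRate F A m ε) atTop (𝓝 0)

/-! ### One-bit compressed sensing -/

/-- The set of `k`-sparse vectors of `ℝⁿ`. -/
def sparse (n k : ℕ) : Set (EuclideanSpace ℝ (Fin n)) :=
  {x | {i | x i ≠ 0}.ncard ≤ k}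

/-- The sign of a real number, as an element of `{-1, 1}`, with value `1` at `0`. -/
def sgn (t : ℝ) : ℤˣ := if 0 ≤ t then 1 else -1

/-- The closed half-space `{a : ⟨a, x⟩ ≥ 0}`. -/
def halfSpace {n : ℕ} (x : EuclideanSpace ℝ (Fin n)) : Set (EuclideanSpace ℝ (Fin n)) :=
  {a | 0 ≤ inner ℝ a x}

theorem measurableSet_halfSpace {n : ℕ} (x : EuclideanSpace ℝ (Fin n)) :
    MeasurableSet (halfSpace x) :=
  (isClosed_le continuous_const (by fun_prop)).measurableSet

/-- The concept class of the half-spaces generated by `k`-sparse vectors. -/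
def halfSpaceClass (n k : ℕ) : ConceptClass (EuclideanSpace ℝ (Fin n)) where
  sets := halfSpace '' sparse n k
  measurableSet := by
    rintro _ ⟨x, -, rfl⟩
    exact measurableSet_halfSpace x

/-- A recovery algorithm: for every `m`, a map that sends `m` measurement vectors together with
their one-bit measurements to an estimate of the unknown vector. -/
def Recovery (n : ℕ) : Type :=
  (m : ℕ) → (Fin m → EuclideanSpace ℝ (Fin n) × ℤˣ) → EuclideanSpace ℝ (Fin n)

/-- The one-bit measurements `sign ⟨a i, x⟩` of `x`, paired with the vectors `a i`. -/
def measure {n m : ℕ} (x : EuclideanSpace ℝ (Fin n)) (a : Fin m → EuclideanSpace ℝ (Fin n)) :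
    Fin m → EuclideanSpace ℝ (Fin n) × ℤˣ :=
  fun i => (a i, sgn (inner ℝ (a i) x))

/-- All estimates are `k`-sparse. -/
def Recovery.IsSparse {n : ℕ} (A : Recovery n) (k : ℕ) : Prop :=
  ∀ m s, A m s ∈ sparse n k

/-- On measurements of a `k`-sparse vector `x`, the estimate has the same signs as `x`. -/
def Recovery.IsConsistent {n : ℕ} (A : Recovery n) (k : ℕ) : Prop :=
  ∀ x ∈ sparse n k, ∀ (m : ℕ) (a : Fin m → EuclideanSpace ℝ (Fin n)) (i : Fin m),
    sgn (inner ℝ (a i) x) = sgn (inner ℝ (a i) (A m (measure x a)))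

/-- The learning algorithm of a recovery algorithm: the labels `b` in `{0, 1}` are turned into the
signs `2 b - 1`, and the hypothesis is the half-space of the estimate. -/
def Recovery.toAlgorithm {n k : ℕ} (A : Recovery n) (hA : A.IsSparse k) :
    Algorithm (halfSpaceClass n k) :=
  fun m s => ⟨halfSpace (A m (fun i => ((s i).1, if (s i).2 then 1 else -1))),
    mem_image_of_mem _ (hA m _)⟩

/-- The generalization error `J(x', x)` of two vectors: that of their half-spaces. -/
def J {n : ℕ} (P : Measure (EuclideanSpace ℝ (Fin n))) (x' x : EuclideanSpace ℝ (Fin n)) : ℝ :=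
  genError P (halfSpace x) (halfSpace x')

/-- The error `ρ(x', x) = E_P |sign ⟨a, x'⟩ - sign ⟨a, x⟩|`. -/
def rho {n : ℕ} (P : Measure (EuclideanSpace ℝ (Fin n))) (x' x : EuclideanSpace ℝ (Fin n)) : ℝ :=
  ∫ a, |(((sgn (inner ℝ a x') : ℤ) : ℝ)) - ((sgn (inner ℝ a x) : ℤ) : ℝ)| ∂P

/-- The uniform distribution on the unit sphere of `ℝⁿ`, as a measure on `ℝⁿ`:
the normalized surface measure. -/
def sphereUniform (n : ℕ) : Measure (EuclideanSpace ℝ (Fin n)) :=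
  (((volume : Measure (EuclideanSpace ℝ (Fin n))).toSphere univ)⁻¹ •
    (volume : Measure (EuclideanSpace ℝ (Fin n))).toSphere).map Subtype.val

/-- `P` is radially invariant: if `a` has law `P`, then `a / ‖a‖` is uniform on the unit sphere. -/
def IsRadiallyInvariant {n : ℕ} (P : Measure (EuclideanSpace ℝ (Fin n))) : Prop :=
  P.map (fun a => ‖a‖⁻¹ • a) = sphereUniform n

/-- The constant `α = min_θ (2/π) θ / (1 - cos θ)` over `θ ∈ [0, 2π]`; at both endpoints the
quotient is undefined (it tends to `∞` there), so they are left out. -/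
def alpha : ℝ :=
  sInf ((fun θ : ℝ => 2 / Real.pi * (θ / (1 - Real.cos θ))) '' Ioo 0 (2 * Real.pi))

end OneBit

end

/-! Consistency says that the sample misses the region where `x` and the estimate have different
signs, and `J` is the probability of that region (`J_eq_measureReal_symmDiff`). It therefore
suffices that, with high probability, no region `symmDiff (halfSpace x) (halfSpace x')` with `x'`
sparse is both missed by the sample and of probability above `ε`. This is uniform over all
candidates `x'`, so the algorithm need not be measurable.

The uniform statement is the Vapnik–Chervonenkis argument. If a region of probability above `ε` is
missed by the first sample, an independent second sample meets it `ε m / 2` times with probability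
at least one half (`half_le_measure_count`). Exchanging entries within pairs preserves the joint
law, and for a fixed trace on the double sample at most a fraction `2 ^ (-r)` of the exchanges
leaves no hit in the first sample and `r` hits in the second (`card_swaps_mul_le`). There are at
most `n ^ k` choices of coordinates times a Sauer–Shelah sum in dimension `k` of traces
(`card_traces_halfSpace_le`). `growth_le_of_sampleSize` checks that the prescribed `m` brings the
resulting bound below `δ`.

For a radially invariant law, `J` is at least the angle divided by `π`: the volume of the wedge
between two half-spaces is additive in the angle and fills the ball at angle `π`. Since the squared
chord is `2 (1 - cos θ)`, the constant `alpha` turns this into a bound on the distance. -/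

noncomputable section

namespace OneBit

/-! ### Counting the traces of half-spaces -/

/-- A set of points shattered by homogeneous linear inequalities in `k` unknowns has at most `k`
elements. -/
theorem card_le_of_shatters_linear {ι : Type*} [DecidableEq ι] {k : ℕ} (v : ι → Fin k → ℝ)
    {𝒜 : Finset (Finset ι)}
    (h𝒜 : ∀ t ∈ 𝒜, ∃ c : Fin k → ℝ, ∀ i, i ∈ t ↔ 0 ≤ ∑ j, c j * v i j)
    {s : Finset ι} (hs : 𝒜.Shatters s) : s.card ≤ k := by
  by_contra! hlt
  have hdep : ¬ LinearIndependent ℝ (fun i : s => v i) := fun hli => by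
    have := hli.fintype_card_le_finrank
    simp at this
    omega
  obtain ⟨g, hg, i₀, hi₀⟩ := Fintype.not_linearIndependent_iff.1 hdep
  -- A negative coefficient is needed: membership is a closed condition, so only the negative side
  -- gives a strict sign.
  obtain ⟨g, hg, i₀, hi₀⟩ : ∃ g : s → ℝ, ∑ i, g i • v i = 0 ∧ ∃ i, g i < 0 := by
    rcases lt_or_gt_of_ne hi₀ with h | h
    · exact ⟨g, hg, i₀, h⟩
    · exact ⟨-g, by simpa using hg, i₀, by simpa using h⟩
  -- Cut out the indices with `0 ≤ g i`. The form `c` realizing this pattern has the signs of `g`,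
  -- so the vanishing sum `∑ g i * ⟨c, v i⟩` would be positive.
  obtain ⟨t, ht, hst⟩ := hs (t := s.attach.filter (fun i => 0 ≤ g i) |>.map ⟨Subtype.val,
    Subtype.val_injective⟩) (by
      intro i hi
      simp only [Finset.mem_map, Finset.mem_filter, Function.Embedding.coeFn_mk] at hi
      obtain ⟨j, -, rfl⟩ := hi
      exact j.2)
  obtain ⟨c, hc⟩ := h𝒜 t ht
  have hmem : ∀ i : s, 0 ≤ ∑ j, c j * v i j ↔ 0 ≤ g i := by
    intro i
    have : (i : ι) ∈ s ∩ t ↔ 0 ≤ g i := by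
      rw [hst]
      simp
    rw [← hc, ← this]
    simp
  have hsum : ∑ i, g i * ∑ j, c j * v i j = 0 := by
    have : ∀ j, ∑ i, g i * v i j = 0 := fun j => by simpa using congrFun hg j
    simp_rw [Finset.mul_sum]
    rw [Finset.sum_comm]
    refine Finset.sum_eq_zero fun j _ => ?_
    rw [← mul_zero (c j), ← this j, Finset.mul_sum]
    exact Finset.sum_congr rfl fun i _ => by ring
  refine hsum.not_gt (Finset.sum_pos' (fun i _ => ?_) ⟨i₀, Finset.mem_univ _, ?_⟩)
  · by_cases h : 0 ≤ g i
    · exact mul_nonneg h ((hmem i).2 h)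
    · have h' := (hmem i).not.2 h
      exact mul_nonneg_of_nonpos_of_nonpos (not_le.1 h).le (not_le.1 h').le
  · exact mul_pos_of_neg_of_neg hi₀ (not_le.1 ((hmem i₀).not.2 hi₀.not_ge))

/-- The number of sign patterns of homogeneous linear inequalities in `k` unknowns. -/
theorem card_le_sum_choose_of_linear {ι : Type*} [Fintype ι] [DecidableEq ι] {k : ℕ}
    (v : ι → Fin k → ℝ) {𝒜 : Finset (Finset ι)}
    (h𝒜 : ∀ t ∈ 𝒜, ∃ c : Fin k → ℝ, ∀ i, i ∈ t ↔ 0 ≤ ∑ j, c j * v i j) :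
    𝒜.card ≤ ∑ j ∈ Finset.Iic k, (Fintype.card ι).choose j := by
  refine 𝒜.card_le_card_shatterer.trans (Finset.card_shatterer_le_sum_vcDim.trans ?_)
  refine Finset.sum_le_sum_of_subset (Finset.Iic_subset_Iic.2 ?_)
  exact Finset.sup_le fun s hs => card_le_of_shatters_linear v h𝒜 (Finset.mem_shatterer.1 hs)

theorem exists_inner_eq_of_mem_sparse {n k : ℕ} (hn : 1 ≤ n) {x : EuclideanSpace ℝ (Fin n)}
    (hx : x ∈ sparse n k) :
    ∃ (σ : Fin k → Fin n) (c : Fin k → ℝ), ∀ a : EuclideanSpace ℝ (Fin n),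
      inner ℝ a x = ∑ j, c j * a (σ j) := by
  classical
  have hcard : Fintype.card {i | x i ≠ 0} ≤ Fintype.card (Fin k) := by
    rw [Fintype.card_fin, ← Nat.card_eq_fintype_card, Nat.card_coe_set_eq]
    exact hx
  obtain ⟨e⟩ := Function.Embedding.nonempty_of_card_le hcard
  -- The support embeds into `Fin k`. Unused slots get coefficient `0` and the dummy coordinate `0`,
  -- which exists because `1 ≤ n`.
  refine ⟨Function.extend e Subtype.val fun _ => ⟨0, hn⟩,
    Function.extend e (fun i => x i) 0, fun a => ?_⟩
  have h₁ : ∑ i : {i | x i ≠ 0}, x i * a i = ∑ i, x i * a i :=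
    Fintype.sum_of_injective Subtype.val Subtype.val_injective _ _
      (fun i hi => by
        have : x i = 0 := by simpa using hi
        simp [this]) (fun _ => rfl)
  have h₂ : inner ℝ a x = ∑ i, x i * a i := by simp [PiLp.inner_apply]
  rw [h₂, ← h₁]
  refine Fintype.sum_of_injective e e.injective _ _ (fun j hj => ?_) (fun i => ?_)
  · rw [show Function.extend e (fun i => x i) 0 j = 0 from
      Function.extend_apply' _ _ _ (by simpa using hj), zero_mul]
  · rw [e.injective.extend_apply, e.injective.extend_apply]

/-- The growth function of the half-spaces generated by `k`-sparse vectors. -/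
theorem card_traces_halfSpace_le {ι : Type*} [Fintype ι] [DecidableEq ι] {n k : ℕ} (hn : 1 ≤ n)
    (a : ι → EuclideanSpace ℝ (Fin n)) (𝒜 : Finset (Finset ι))
    (h𝒜 : ∀ t ∈ 𝒜, ∃ x ∈ sparse n k, ∀ i, i ∈ t ↔ a i ∈ halfSpace x) :
    𝒜.card ≤ n ^ k * ∑ j ∈ Finset.Iic k, (Fintype.card ι).choose j := by
  classical
  -- Once the coordinates `σ` are fixed, the patterns come from linear forms in `k` unknowns; there
  -- are `n ^ k` maps `σ`.
  let 𝒯 : (Fin k → Fin n) → Finset (Finset ι) := fun σ =>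
    𝒜.filter fun t => ∃ c : Fin k → ℝ, ∀ i, i ∈ t ↔ 0 ≤ ∑ j, c j * a i (σ j)
  have hsub : 𝒜 ⊆ Finset.univ.biUnion 𝒯 := fun t ht => by
    obtain ⟨x, hx, hxt⟩ := h𝒜 t ht
    obtain ⟨σ, c, hc⟩ := exists_inner_eq_of_mem_sparse hn hx
    exact Finset.mem_biUnion.2 ⟨σ, Finset.mem_univ _,
      Finset.mem_filter.2 ⟨ht, c, fun i => by rw [hxt, ← hc]; rfl⟩⟩
  refine (Finset.card_le_card hsub).trans ((Finset.card_biUnion_le_card_mul _ _ _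
    fun σ _ => card_le_sum_choose_of_linear (fun i j => a i (σ j))
      fun t ht => (Finset.mem_filter.1 ht).2).trans_eq ?_)
  simp

/-- With `q = k / N ≤ 1`, weighting each term by `q ^ k ≤ q ^ j` bounds the sum by the binomial
expansion of `(1 + q) ^ N ≤ exp k`. -/
theorem sum_choose_le_rpow {k N : ℕ} (hk : 1 ≤ k) (hkN : k ≤ N) :
    ((∑ j ∈ Finset.Iic k, N.choose j : ℕ) : ℝ) ≤ (Real.exp 1 * N / k) ^ k := by
  have hk0 : (0 : ℝ) < k := by exact_mod_cast hk
  have hN0 : (0 : ℝ) < N := by exact_mod_cast hk.trans hkN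
  set q : ℝ := k / N with hq
  have hq0 : 0 < q := by positivity
  have hq1 : q ≤ 1 := by
    rw [hq, div_le_one hN0]
    exact_mod_cast hkN
  have h₁ : q ^ k * ∑ j ∈ Finset.Iic k, (N.choose j : ℝ) ≤ (1 + q) ^ N := by
    have hb : (1 + q) ^ N = ∑ j ∈ Finset.range (N + 1), q ^ j * (N.choose j : ℝ) := by
      rw [add_comm, add_pow]
      simp
    rw [hb, Finset.mul_sum]
    calc ∑ j ∈ Finset.Iic k, q ^ k * (N.choose j : ℝ)
        ≤ ∑ j ∈ Finset.Iic k, q ^ j * (N.choose j : ℝ) := by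
          refine Finset.sum_le_sum fun j hj => ?_
          have := pow_le_pow_of_le_one hq0.le hq1 (Finset.mem_Iic.1 hj)
          gcongr
      _ ≤ _ := by
          refine Finset.sum_le_sum_of_subset_of_nonneg (fun j hj => ?_) fun j _ _ => by positivity
          have := Finset.mem_Iic.1 hj
          exact Finset.mem_range.2 (by omega)
  have h₂ : (1 + q) ^ N ≤ Real.exp 1 ^ k := by
    calc (1 + q) ^ N ≤ (Real.exp q) ^ N := by
          gcongr
          linarith [Real.add_one_le_exp q]
      _ = Real.exp 1 ^ k := by
          rw [← Real.exp_nat_mul, ← Real.exp_nat_mul, hq]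
          congr 1
          field_simp
  have h₃ : Real.exp 1 * N / k = Real.exp 1 / q := by
    rw [hq]
    field_simp
  rw [h₃, div_pow, le_div_iff₀ (by positivity), mul_comm]
  push_cast
  exact h₁.trans h₂

/-! ### Symmetrization by a second sample -/

/-- The point of a pair selected by a Boolean. -/
def pick {X : Type*} (p : X × X) (b : Bool) : X := if b then p.2 else p.1

/-- Exchange the entries of those pairs that are marked by `σ`. -/
def swapBy {X : Type*} {m : ℕ} (σ : Fin m → Bool) (z : Fin m → X × X) : Fin m → X × X :=
  fun i => if σ i then (z i).swap else z i

theorem swapBy_fst {X : Type*} {m : ℕ} (σ : Fin m → Bool) (z : Fin m → X × X) (i : Fin m) :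
    (swapBy σ z i).1 = pick (z i) (σ i) := by
  cases h : σ i <;> simp [swapBy, pick, h]

theorem swapBy_snd {X : Type*} {m : ℕ} (σ : Fin m → Bool) (z : Fin m → X × X) (i : Fin m) :
    (swapBy σ z i).2 = pick (z i) (!σ i) := by
  cases h : σ i <;> simp [swapBy, pick, h]

theorem measurePreserving_swapBy {X : Type*} [MeasurableSpace X] (P : Measure X) [SigmaFinite P]
    {m : ℕ} (σ : Fin m → Bool) :
    MeasurePreserving (swapBy σ) (Measure.pi fun _ : Fin m => P.prod P)
      (Measure.pi fun _ => P.prod P) := by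
  have h : ∀ i, MeasurePreserving (fun p : X × X => if σ i then p.swap else p)
      (P.prod P) (P.prod P) := fun i => by
    cases h : σ i
    · simpa using! MeasurePreserving.id (P.prod P)
    · simpa using Measure.measurePreserving_swap
  exact measurePreserving_pi _ _ h

/-- For a fixed trace on the double sample, few exchanges make the first sample miss it while the
second sample meets it `r` times. -/
theorem card_swaps_mul_le {m : ℕ} (s : Finset (Fin m × Bool)) (r : ℕ) :
    (Finset.univ.filter fun σ : Fin m → Bool => (∀ i, (i, σ i) ∉ s) ∧
      r ≤ (Finset.univ.filter fun i => (i, !σ i) ∈ s).card).card * 2 ^ r ≤ 2 ^ m := by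
  classical
  set S := Finset.univ.filter fun σ : Fin m → Bool => (∀ i, (i, σ i) ∉ s) ∧
      r ≤ (Finset.univ.filter fun i => (i, !σ i) ∈ s).card with hS
  rcases S.eq_empty_or_nonempty with h | ⟨σ₀, hσ₀⟩
  · simp [h]
  obtain ⟨-, hmiss, hr⟩ := Finset.mem_filter.1 hσ₀
  set T := Finset.univ.filter fun i => (i, !σ₀ i) ∈ s with hT
  -- At an index of `T`, an exchange that differs from `σ₀` would move the hit into the first
  -- sample. So all of `S` agrees with `σ₀` on the at least `r` indices of `T`.
  have hsub : S ⊆ Fintype.piFinset fun i => if i ∈ T then {σ₀ i} else Finset.univ := fun σ hσ => by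
    refine Fintype.mem_piFinset.2 fun i => ?_
    split_ifs with hi
    · obtain ⟨-, hσm, -⟩ := Finset.mem_filter.1 hσ
      have hi' := (Finset.mem_filter.1 hi).2
      by_contra hne
      have : σ i = !σ₀ i := by
        rw [Finset.mem_singleton] at hne
        exact Bool.eq_not.2 hne
      exact hσm i (this ▸ hi')
    · exact Finset.mem_univ _
  have hcard : (Fintype.piFinset fun i => if i ∈ T then {σ₀ i} else Finset.univ).card
      = 2 ^ (m - T.card) := by
    rw [Fintype.card_piFinset]
    have : ∀ i, (if i ∈ T then {σ₀ i} else (Finset.univ : Finset Bool)).card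
        = if i ∈ T then 1 else 2 := fun i => by split_ifs <;> simp
    simp_rw [this]
    rw [Finset.prod_ite]
    simp only [Finset.prod_const, one_pow, one_mul]
    congr 1
    rw [← Finset.compl_filter, Finset.card_compl, Fintype.card_fin]
    simp
  have hTm : T.card ≤ m := by simpa using T.card_le_univ
  calc S.card * 2 ^ r ≤ 2 ^ (m - T.card) * 2 ^ T.card :=
        Nat.mul_le_mul ((Finset.card_le_card hsub).trans_eq hcard) (Nat.pow_le_pow_right two_pos hr)
    _ = 2 ^ m := by rw [← pow_add, Nat.sub_add_cancel hTm]

/-- The double samples for which some region of the class is missed by the first sample and met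
`r` times by the second one. -/
def doubleBad {X : Type*} (𝒟 : Set (Set X)) (m r : ℕ) : Set (Fin m → X × X) :=
  {z | ∃ D ∈ 𝒟, (∀ i, (z i).1 ∉ D) ∧ r ≤ {i | (z i).2 ∈ D}.ncard}

/-- The double samples on which some region of the class has trace `s`. -/
def hasTrace {X : Type*} (𝒟 : Set (Set X)) {m : ℕ} (s : Finset (Fin m × Bool)) :
    Set (Fin m → X × X) :=
  {z | ∃ D ∈ 𝒟, ∀ j, j ∈ s ↔ pick (z j.1) j.2 ∈ D}

/-- Whether an exchanged sample is bad depends on `z` only through the traces it admits, which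
reduces the problem to counting over finite sets. -/
theorem swapBy_mem_doubleBad_iff {X : Type*} {𝒟 : Set (Set X)} {m r : ℕ} (σ : Fin m → Bool)
    (z : Fin m → X × X) :
    swapBy σ z ∈ doubleBad 𝒟 m r ↔ ∃ s : Finset (Fin m × Bool), z ∈ hasTrace 𝒟 s ∧
      (∀ i, (i, σ i) ∉ s) ∧ r ≤ (Finset.univ.filter fun i => (i, !σ i) ∈ s).card := by
  classical
  have key : ∀ (s : Finset (Fin m × Bool)) (D : Set X), (∀ j, j ∈ s ↔ pick (z j.1) j.2 ∈ D) →
      (((∀ i, (swapBy σ z i).1 ∉ D) ∧ r ≤ {i | (swapBy σ z i).2 ∈ D}.ncard) ↔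
      ((∀ i, (i, σ i) ∉ s) ∧ r ≤ (Finset.univ.filter fun i => (i, !σ i) ∈ s).card)) := by
    intro s D h
    have : {i | (swapBy σ z i).2 ∈ D}
        = ((Finset.univ.filter fun i => (i, !σ i) ∈ s : Finset (Fin m)) : Set (Fin m)) := by
      ext i
      simp [swapBy_snd, h]
    rw [this, Set.ncard_coe_finset]
    simp [swapBy_fst, h]
  constructor
  · rintro ⟨D, hD, h⟩
    have ht : ∀ j, j ∈ (Finset.univ.filter fun j : Fin m × Bool => pick (z j.1) j.2 ∈ D) ↔
        pick (z j.1) j.2 ∈ D := fun j => by simp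
    exact ⟨_, ⟨D, hD, ht⟩, (key _ D ht).1 h⟩
  · rintro ⟨s, ⟨D, hD, ht⟩, h⟩
    exact ⟨D, hD, (key s D ht).2 h⟩

theorem measurableSet_doubleBad {X : Type*} [MeasurableSpace X] {𝒟 : Set (Set X)} {m r : ℕ}
    (hmeas : ∀ s : Finset (Fin m × Bool), MeasurableSet (hasTrace 𝒟 s)) :
    MeasurableSet (doubleBad 𝒟 m r) := by
  have : doubleBad 𝒟 m r = ⋃ s ∈ {s : Finset (Fin m × Bool) | (∀ i, (i, false) ∉ s) ∧
      r ≤ (Finset.univ.filter fun i => (i, true) ∈ s).card}, hasTrace 𝒟 s := by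
    ext z
    have := swapBy_mem_doubleBad_iff (𝒟 := 𝒟) (r := r) (fun _ => false) z
    rw [show swapBy (fun _ => false) z = z from rfl] at this
    rw [this]
    simp only [Bool.not_false, mem_iUnion, exists_prop, mem_ofPred_eq]
    exact exists_congr fun s => and_comm
  rw [this]
  exact MeasurableSet.biUnion (Set.to_countable _) fun s _ => hmeas s

theorem card_swapBy_mem_doubleBad_mul_le {X : Type*} {𝒟 : Set (Set X)} {m G : ℕ} (r : ℕ)
    (z : Fin m → X × X)
    (hG : ∀ 𝒜 : Finset (Finset (Fin m × Bool)), (∀ s ∈ 𝒜, z ∈ hasTrace 𝒟 s) → 𝒜.card ≤ G)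
    (S : Finset (Fin m → Bool)) (hS : ∀ σ ∈ S, swapBy σ z ∈ doubleBad 𝒟 m r) :
    S.card * 2 ^ r ≤ G * 2 ^ m := by
  classical
  set 𝒜 := Finset.univ.filter fun s : Finset (Fin m × Bool) => z ∈ hasTrace 𝒟 s with h𝒜
  set F : Finset (Fin m × Bool) → Finset (Fin m → Bool) := fun s =>
    Finset.univ.filter fun σ : Fin m → Bool => (∀ i, (i, σ i) ∉ s) ∧
      r ≤ (Finset.univ.filter fun i => (i, !σ i) ∈ s).card
  have hsub : S ⊆ 𝒜.biUnion F := fun σ hσ => by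
    obtain ⟨s, hs, h⟩ := (swapBy_mem_doubleBad_iff σ z).1 (hS σ hσ)
    exact Finset.mem_biUnion.2 ⟨s, Finset.mem_filter.2 ⟨Finset.mem_univ _, hs⟩,
      Finset.mem_filter.2 ⟨Finset.mem_univ _, h⟩⟩
  calc S.card * 2 ^ r ≤ (∑ s ∈ 𝒜, (F s).card) * 2 ^ r := by
        gcongr
        exact (Finset.card_le_card hsub).trans Finset.card_biUnion_le
    _ = ∑ s ∈ 𝒜, (F s).card * 2 ^ r := Finset.sum_mul _ _ _
    _ ≤ ∑ _s ∈ 𝒜, 2 ^ m := Finset.sum_le_sum fun s _ => card_swaps_mul_le s r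
    _ = 𝒜.card * 2 ^ m := by simp
    _ ≤ G * 2 ^ m := by
        gcongr
        exact hG 𝒜 fun s hs => (Finset.mem_filter.1 hs).2

/-- All `2 ^ m` exchanges preserve the law, so the probability is the mean over samples of the
fraction of bad exchanges; the union bound over at most `G` traces holds at every sample. -/
theorem measure_doubleBad_mul_le {X : Type*} [MeasurableSpace X] (P : Measure X)
    [IsProbabilityMeasure P] {𝒟 : Set (Set X)} {m G : ℕ} (r : ℕ)
    (hmeas : ∀ s : Finset (Fin m × Bool), MeasurableSet (hasTrace 𝒟 s))
    (hG : ∀ z : Fin m → X × X, ∀ 𝒜 : Finset (Finset (Fin m × Bool)),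
      (∀ s ∈ 𝒜, z ∈ hasTrace 𝒟 s) → 𝒜.card ≤ G) :
    (Measure.pi fun _ : Fin m => P.prod P) (doubleBad 𝒟 m r) * 2 ^ r ≤ G := by
  classical
  set Q := Measure.pi fun _ : Fin m => P.prod P
  set B := doubleBad 𝒟 m r
  have hB : MeasurableSet B := measurableSet_doubleBad hmeas
  have hσ : ∀ σ : Fin m → Bool, ∫⁻ z, B.indicator 1 (swapBy σ z) ∂Q = Q B := fun σ => by
    rw [(measurePreserving_swapBy P σ).lintegral_comp (measurable_one.indicator hB),
      lintegral_indicator_one hB]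
  have hsum : (2 : ENNReal) ^ m * Q B
      = ∫⁻ z, ∑ σ : Fin m → Bool, B.indicator 1 (swapBy σ z) ∂Q := by
    rw [lintegral_finsetSum]
    · simp [hσ]
    · exact fun σ _ => (measurable_one.indicator hB).comp (measurePreserving_swapBy P σ).measurable
  have hle : ∀ z, (∑ σ : Fin m → Bool, B.indicator (1 : (Fin m → X × X) → ENNReal) (swapBy σ z)) * 2 ^ r
      ≤ G * 2 ^ m := fun z => by
    have h₁ : ∑ σ : Fin m → Bool, B.indicator (1 : (Fin m → X × X) → ENNReal) (swapBy σ z)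
        = ((Finset.univ.filter fun σ => swapBy σ z ∈ B).card : ENNReal) := by
      simp [Set.indicator_apply]
    rw [h₁]
    exact_mod_cast card_swapBy_mem_doubleBad_mul_le r z (hG z) _
      fun σ h => (Finset.mem_filter.1 h).2
  have h2 : (2 : ENNReal) ^ m ≠ 0 := by simp
  have h2' : (2 : ENNReal) ^ m ≠ ⊤ := by finiteness
  rw [← ENNReal.mul_le_mul_iff_right h2 h2', ← mul_assoc, hsum,
    ← lintegral_mul_const' _ _ (by finiteness), mul_comm _ (G : ENNReal)]
  refine (lintegral_mono hle).trans_eq ?_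
  simp

/-- A region of probability at least `ε` is met at least `ε m / 2` times with probability at least
one half. -/
theorem half_le_measure_count {X : Type*} [MeasurableSpace X] (P : Measure X)
    [IsProbabilityMeasure P] {D : Set X} (hD : MeasurableSet D) {ε : ℝ} (hε : ε ≤ P.real D)
    {m : ℕ} (hm : 8 ≤ ε * m) :
    (1 / 2 : ENNReal) ≤ (Measure.pi fun _ : Fin m => P)
      {b | ⌈ε * m / 2⌉₊ ≤ {i | b i ∈ D}.ncard} := by
  classical
  set μ := Measure.pi fun _ : Fin m => P
  -- Chernoff's method: the product of the `f (b i)` is `2 ^ (-count)`, and Markov's inequality for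
  -- it bounds the probability of a small count.
  set f : X → ℝ := fun x => 1 - D.indicator (fun _ => 1 / 2) x with hf
  have hf0 : ∀ x, 0 ≤ f x := fun x => by
    by_cases h : x ∈ D <;> simp [hf, h]
    norm_num
  have hfm : Measurable f := by fun_prop (disch := assumption)
  have hf1 : ∀ x, f x ≤ 1 := fun x => by by_cases h : x ∈ D <;> simp [hf, h]
  have hint : ∫ x, f x ∂P = 1 - P.real D / 2 := by
    rw [hf, integral_sub (integrable_const _) ((integrable_const _).indicator hD),
      integral_indicator hD]
    simp
    ring
  have hprod : ∫ b, ∏ i, f (b i) ∂μ ≤ Real.exp (-(ε * m / 2)) := by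
    rw [integral_fintype_prod_eq_pow (ι := Fin m) f, Fintype.card_fin, hint]
    calc (1 - P.real D / 2) ^ m ≤ Real.exp (-(ε / 2)) ^ m := by
          have h₁ : P.real D ≤ 1 := measureReal_le_one
          have := Real.add_one_le_exp (-(ε / 2))
          exact pow_le_pow_left₀ (by linarith) (by linarith) m
      _ = Real.exp (-(ε * m / 2)) := by
          rw [← Real.exp_nat_mul]
          ring_nf
  have hval : ∀ b : Fin m → X, ∏ i, f (b i) = (2 : ℝ)⁻¹ ^ {i | b i ∈ D}.ncard := fun b => by
    have : ∀ i, f (b i) = if b i ∈ D then 2⁻¹ else 1 := fun i => by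
      by_cases h : b i ∈ D <;> simp [hf, h]
      norm_num
    simp_rw [this]
    rw [Finset.prod_ite]
    simp [Set.ncard_eq_toFinset_card']
  have hMark := mul_meas_ge_le_integral_of_nonneg (μ := μ) (f := fun b => ∏ i, f (b i))
    (ae_of_all _ fun b => Finset.prod_nonneg fun i _ => hf0 _)
    (Integrable.of_bound (C := 1) (Measurable.aestronglyMeasurable (by fun_prop)) (ae_of_all _ fun b => by
      rw [Real.norm_of_nonneg (Finset.prod_nonneg fun i _ => hf0 _)]
      exact Finset.prod_le_one (fun i _ => hf0 _) fun i _ => hf1 _))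
    (Real.exp (-(Real.log 2 * (ε * m / 2))))
  set E := {b : Fin m → X | Real.exp (-(Real.log 2 * (ε * m / 2))) ≤ ∏ i, f (b i)} with hE
  have hEm : MeasurableSet E := measurableSet_le measurable_const (by fun_prop)
  have hcompl : Eᶜ ⊆ {b : Fin m → X | ⌈ε * m / 2⌉₊ ≤ {i | b i ∈ D}.ncard} := fun b hb => by
    simp only [hE, mem_compl_iff, mem_ofPred_eq, not_le, hval] at hb
    refine Nat.ceil_le.2 (le_of_lt ?_)
    have h2 : (2 : ℝ)⁻¹ ^ {i | b i ∈ D}.ncard = Real.exp (-(Real.log 2 * {i | b i ∈ D}.ncard)) := by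
      rw [mul_comm, ← mul_neg, Real.exp_nat_mul, Real.exp_neg, Real.exp_log two_pos]
    rw [h2, Real.exp_lt_exp, neg_lt_neg_iff] at hb
    exact lt_of_mul_lt_mul_left hb (Real.log_nonneg one_le_two)
  have hEle : μ.real E ≤ 1 / 2 := by
    have h₁ : μ.real E ≤ Real.exp (-(ε * m / 2)) / Real.exp (-(Real.log 2 * (ε * m / 2))) := by
      rw [le_div_iff₀ (Real.exp_pos _), mul_comm]
      exact hMark.trans hprod
    refine h₁.trans ?_
    rw [← Real.exp_sub, one_div, ← Real.exp_log (show (0 : ℝ) < 2⁻¹ by norm_num), Real.exp_le_exp,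
      Real.log_inv]
    -- Since `ε m / 2 ≥ 4`, the exponent `(1 - log 2) ε m / 2` exceeds `log 2`.
    nlinarith [Real.log_two_lt_d9]
  have hEc : (1 / 2 : ℝ) ≤ μ.real Eᶜ := by
    rw [probReal_compl_eq_one_sub hEm]
    linarith
  refine le_trans ?_ (measure_mono hcompl)
  have := ENNReal.ofReal_le_ofReal hEc
  rw [ofReal_measureReal] at this
  refine le_trans (le_of_eq ?_) this
  rw [ENNReal.ofReal_div_of_pos two_pos]
  simp

/-- The probability that some region of probability more than `ε` of a class is missed by the
sample. -/
theorem measure_exists_missed_le {X : Type*} [MeasurableSpace X] (P : Measure X)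
    [IsProbabilityMeasure P] {𝒟 : Set (Set X)} (h𝒟 : ∀ D ∈ 𝒟, MeasurableSet D) {m G : ℕ}
    (hmeas : ∀ s : Finset (Fin m × Bool), MeasurableSet (hasTrace 𝒟 s))
    (hG : ∀ z : Fin m → X × X, ∀ 𝒜 : Finset (Finset (Fin m × Bool)),
      (∀ s ∈ 𝒜, z ∈ hasTrace 𝒟 s) → 𝒜.card ≤ G)
    {ε : ℝ} (hm : 8 ≤ ε * m) :
    (Measure.pi fun _ : Fin m => P) {c | ∃ D ∈ 𝒟, (∀ i, c i ∉ D) ∧ ε < P.real D}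
      ≤ ENNReal.ofReal (2 * G / 2 ^ (ε * m / 2)) := by
  set μ := Measure.pi fun _ : Fin m => P
  set r := ⌈ε * m / 2⌉₊
  set e := MeasurableEquiv.arrowProdEquivProdArrow X X (Fin m)
  have he : MeasurePreserving e (Measure.pi fun _ : Fin m => P.prod P) (μ.prod μ) :=
    measurePreserving_arrowProdEquivProdArrow X X (Fin m) (fun _ => P) (fun _ => P)
  set B := e.symm ⁻¹' doubleBad 𝒟 m r with hBdef
  have hB : MeasurableSet B := e.symm.measurable (measurableSet_doubleBad hmeas)
  have hBQ : (μ.prod μ) B = (Measure.pi fun _ : Fin m => P.prod P) (doubleBad 𝒟 m r) :=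
    (he.symm e).measure_preimage (measurableSet_doubleBad hmeas).nullMeasurableSet
  -- The event on the left need not be known to be measurable; it lies in a measurable set of first
  -- samples, to which Markov's inequality applies.
  have hsub : {c : Fin m → X | ∃ D ∈ 𝒟, (∀ i, c i ∉ D) ∧ ε < P.real D}
      ⊆ {c | 1 / 2 ≤ μ (Prod.mk c ⁻¹' B)} := by
    rintro c ⟨D, hD, hmiss, hPD⟩
    refine (half_le_measure_count P (h𝒟 D hD) hPD.le hm).trans (measure_mono fun b hb => ?_)
    exact ⟨D, hD, hmiss, hb⟩
  have h₁ : 1 / 2 * μ {c | 1 / 2 ≤ μ (Prod.mk c ⁻¹' B)} ≤ (μ.prod μ) B := by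
    rw [Measure.prod_apply hB]
    exact mul_meas_ge_le_lintegral (measurable_measure_prodMk_left hB) _
  have h₂ := measure_doubleBad_mul_le P r hmeas hG
  rw [← hBQ] at h₂
  refine (measure_mono hsub).trans ?_
  set p := μ {c | 1 / 2 ≤ μ (Prod.mk c ⁻¹' B)} with hp
  have hpt : p ≠ ⊤ := measure_ne_top _ _
  have hqt : (μ.prod μ) B ≠ ⊤ := measure_ne_top _ _
  have h₁' : 1 / 2 * p.toReal ≤ ((μ.prod μ) B).toReal := by
    have := ENNReal.toReal_mono hqt h₁
    simpa using this
  have h₂' : ((μ.prod μ) B).toReal * 2 ^ r ≤ G := by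
    have := ENNReal.toReal_mono (by finiteness) h₂
    simpa using this
  rw [← ENNReal.ofReal_toReal hpt]
  refine ENNReal.ofReal_le_ofReal ?_
  have h₃ : (2 : ℝ) ^ (ε * m / 2) ≤ 2 ^ r := by
    rw [← Real.rpow_natCast]
    exact Real.rpow_le_rpow_of_exponent_le one_le_two (Nat.le_ceil _)
  rw [le_div_iff₀ (by positivity)]
  have h₄ : p.toReal * (2 : ℝ) ^ (ε * m / 2) ≤ p.toReal * 2 ^ r := by gcongr
  nlinarith [pow_pos (two_pos (α := ℝ)) r]

/-! ### Consistent recovery of sparse vectors -/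

theorem isClosed_sparse (n k : ℕ) : IsClosed (sparse n k) := by
  classical
  have : sparse n k = ⋃ T ∈ {T : Finset (Fin n) | T.card ≤ k},
      {x : EuclideanSpace ℝ (Fin n) | ∀ i ∉ T, x i = 0} := by
    ext x
    simp only [sparse, mem_ofPred_eq, mem_iUnion, exists_prop]
    constructor
    · intro h
      refine ⟨Finset.univ.filter fun i => x i ≠ 0, ?_, fun i hi => by simpa using hi⟩
      rw [← Set.ncard_coe_finset]
      simpa using h
    · rintro ⟨T, hT, hx⟩
      refine le_trans ?_ hT
      rw [← Set.ncard_coe_finset]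
      refine Set.ncard_le_ncard (fun i hi => ?_) T.finite_toSet
      by_contra h
      exact hi (hx i h)
  rw [this]
  refine (Set.toFinite _).isClosed_biUnion fun T _ => ?_
  simp only [ofPred_forall]
  exact isClosed_iInter fun i => isClosed_iInter fun _ =>
    isClosed_eq (by fun_prop) continuous_const

/-- The set of configurations with a given sign pattern is a projection of an `F_σ` set. -/
theorem measurableSet_exists_pattern {n : ℕ} {Z ι : Type*} [TopologicalSpace Z] [T2Space Z]
    [SigmaCompactSpace Z] [MeasurableSpace Z] [OpensMeasurableSpace Z] [Finite ι]
    {K : Set (EuclideanSpace ℝ (Fin n))} (hK : IsClosed K)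
    (a : Z → ι → EuclideanSpace ℝ (Fin n)) (ha : ∀ j, Continuous fun z => a z j) (s : Set ι) :
    MeasurableSet {z | ∃ x ∈ K, ∀ j, j ∈ s ↔ a z j ∈ halfSpace x} := by
  classical
  have := Fintype.ofFinite ι
  -- Strict negativity is replaced by a margin `1 / (q + 1)`, which makes each `W q` closed; as `ι`
  -- is finite, one `q` serves all indices.
  let W : ℕ → Set (Z × EuclideanSpace ℝ (Fin n)) := fun q =>
    {p | p.2 ∈ K ∧ (∀ j ∈ s, 0 ≤ inner ℝ (a p.1 j) p.2) ∧
      ∀ j ∉ s, inner ℝ (a p.1 j) p.2 ≤ -(1 / ((q : ℝ) + 1))}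
  have hc : ∀ j, Continuous fun p : Z × EuclideanSpace ℝ (Fin n) => inner ℝ (a p.1 j) p.2 :=
    fun j => ((ha j).comp continuous_fst).inner continuous_snd
  have hW : ∀ q, IsClosed (W q) := fun q => by
    have h₁ : IsClosed {p : Z × EuclideanSpace ℝ (Fin n) | ∀ j ∈ s, 0 ≤ inner ℝ (a p.1 j) p.2} := by
      simp only [ofPred_forall]
      exact isClosed_iInter fun j => isClosed_iInter fun _ => isClosed_le continuous_const (hc j)
    have h₂ : IsClosed {p : Z × EuclideanSpace ℝ (Fin n) |
        ∀ j ∉ s, inner ℝ (a p.1 j) p.2 ≤ -(1 / ((q : ℝ) + 1))} := by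
      simp only [ofPred_forall]
      exact isClosed_iInter fun j => isClosed_iInter fun _ => isClosed_le (hc j) continuous_const
    exact (hK.preimage continuous_snd).inter (h₁.inter h₂)
  have heq : {z | ∃ x ∈ K, ∀ j, j ∈ s ↔ a z j ∈ halfSpace x} = ⋃ q, Prod.fst '' W q := by
    ext z
    simp only [mem_ofPred_eq, mem_iUnion, mem_image, Prod.exists, exists_and_right, exists_eq_right]
    constructor
    · rintro ⟨x, hx, h⟩
      have hq : ∀ j, ∃ q : ℕ, j ∉ s → 1 / ((q : ℝ) + 1) < -inner ℝ (a z j) x := fun j => by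
        by_cases hj : j ∈ s
        · exact ⟨0, fun h => (h hj).elim⟩
        · have : ¬ 0 ≤ inner ℝ (a z j) x := (h j).not.1 hj
          obtain ⟨q, hq⟩ := exists_nat_one_div_lt (neg_pos.2 (not_le.1 this))
          exact ⟨q, fun _ => hq⟩
      choose q hq using hq
      refine ⟨Finset.univ.sup q, x, hx, fun j hj => (h j).1 hj, fun j hj => ?_⟩
      have h₁ : (q j : ℝ) ≤ (Finset.univ.sup q : ℕ) :=
        Nat.cast_le.2 (Finset.le_sup (Finset.mem_univ j))
      have h₂ : 1 / (((Finset.univ.sup q : ℕ) : ℝ) + 1) ≤ 1 / ((q j : ℝ) + 1) :=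
        one_div_le_one_div_of_le (by positivity) (by linarith)
      have := hq j hj
      change inner ℝ (a z j) x ≤ _
      linarith
    · rintro ⟨q, x, hx, h₁, h₂⟩
      refine ⟨x, hx, fun j => ⟨h₁ j, fun hj => ?_⟩⟩
      by_contra hjs
      have h₃ : inner ℝ (a z j) x ≤ -(1 / ((q : ℝ) + 1)) := h₂ j hjs
      have h₄ : (0 : ℝ) < 1 / ((q : ℝ) + 1) := by positivity
      have h₅ : 0 ≤ inner ℝ (a z j) x := hj
      linarith
  rw [heq]
  refine MeasurableSet.iUnion fun q => ?_
  -- A closed subset of a σ-compact space is σ-compact, and so is its projection; compact sets are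
  -- closed in a Hausdorff space.
  obtain ⟨C, hC, hCU⟩ := (isSigmaCompact_univ.of_isClosed_subset (hW q) (subset_univ _)).image continuous_fst
  rw [← hCU]
  exact MeasurableSet.iUnion fun i => (hC i).measurableSet

/-- The regions on which a `k`-sparse vector and `x` have different signs. -/
def errorRegions {n : ℕ} (k : ℕ) (x : EuclideanSpace ℝ (Fin n)) :
    Set (Set (EuclideanSpace ℝ (Fin n))) :=
  (fun x' => symmDiff (halfSpace x) (halfSpace x')) '' sparse n k

theorem continuous_pick {X : Type*} [TopologicalSpace X] {m : ℕ} (j : Fin m × Bool) :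
    Continuous fun z : Fin m → X × X => pick (z j.1) j.2 := by
  rcases j with ⟨i, b⟩
  cases b
  · exact continuous_fst.comp (continuous_apply i)
  · exact continuous_snd.comp (continuous_apply i)

/-- The trace of the half-space of `x` on a double sample. -/
def halfSpaceTrace {n m : ℕ} (x : EuclideanSpace ℝ (Fin n))
    (z : Fin m → EuclideanSpace ℝ (Fin n) × EuclideanSpace ℝ (Fin n)) :
    Set (Fin m × Bool) :=
  {j | pick (z j.1) j.2 ∈ halfSpace x}

/-- Taking traces commutes with symmetric differences. Removing the known trace of `x` reduces error
regions to half-spaces, for counting as well as for measurability. -/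
theorem mem_hasTrace_errorRegions {n k m : ℕ} {x : EuclideanSpace ℝ (Fin n)}
    {s : Finset (Fin m × Bool)}
    {z : Fin m → EuclideanSpace ℝ (Fin n) × EuclideanSpace ℝ (Fin n)} :
    z ∈ hasTrace (errorRegions k x) s ↔ ∃ x' ∈ sparse n k, ∀ j,
      j ∈ symmDiff (halfSpaceTrace x z) (s : Set (Fin m × Bool)) ↔
        pick (z j.1) j.2 ∈ halfSpace x' := by
  simp only [hasTrace, errorRegions, mem_ofPred_eq, exists_mem_image, halfSpaceTrace]
  refine exists_congr fun x' => and_congr_right fun _ => forall_congr' fun j => ?_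
  simp only [Set.mem_symmDiff, mem_ofPred_eq, Finset.mem_coe]
  tauto

theorem measurableSet_hasTrace_errorRegions {n k m : ℕ} (x : EuclideanSpace ℝ (Fin n))
    (s : Finset (Fin m × Bool)) : MeasurableSet (hasTrace (errorRegions k x) s) := by
  have : hasTrace (errorRegions k x) s = ⋃ p : Set (Fin m × Bool),
      {z | halfSpaceTrace x z = p} ∩ {z | ∃ x' ∈ sparse n k, ∀ j,
        j ∈ symmDiff p (s : Set (Fin m × Bool)) ↔ pick (z j.1) j.2 ∈ halfSpace x'} := by
    ext z
    rw [mem_hasTrace_errorRegions]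
    simp
  rw [this]
  refine MeasurableSet.iUnion fun p => MeasurableSet.inter ?_ ?_
  swap
  · have := measurableSet_exists_pattern (isClosed_sparse n k)
      (fun (z : Fin m → EuclideanSpace ℝ (Fin n) × EuclideanSpace ℝ (Fin n)) (j : Fin m × Bool) =>
        pick (z j.1) j.2) (fun j => continuous_pick j) (symmDiff p (s : Set (Fin m × Bool)))
    exact this
  simp only [Set.ext_iff, ofPred_forall, halfSpaceTrace, mem_ofPred_eq]
  refine MeasurableSet.iInter fun j => ?_
  have hj := (continuous_pick j).measurable (measurableSet_halfSpace x)
  by_cases h : j ∈ p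
  · simp only [h, iff_true]
    exact hj
  · simp only [h, iff_false]
    exact hj.compl

theorem card_hasTrace_errorRegions_le {n k m : ℕ} (hn : 1 ≤ n) (x : EuclideanSpace ℝ (Fin n))
    (z : Fin m → EuclideanSpace ℝ (Fin n) × EuclideanSpace ℝ (Fin n))
    (𝒜 : Finset (Finset (Fin m × Bool)))
    (h𝒜 : ∀ s ∈ 𝒜, z ∈ hasTrace (errorRegions k x) s) :
    𝒜.card ≤ n ^ k * ∑ j ∈ Finset.Iic k, (2 * m).choose j := by
  classical
  have hinj := symmDiff_right_injective (halfSpaceTrace x z).toFinset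
  rw [← Finset.card_image_of_injective 𝒜 hinj]
  refine (card_traces_halfSpace_le (k := k) hn (fun j => pick (z j.1) j.2) _ fun t ht => ?_).trans_eq ?_
  · obtain ⟨s, hs, rfl⟩ := Finset.mem_image.1 ht
    obtain ⟨x', hx', h⟩ := mem_hasTrace_errorRegions.1 (h𝒜 s hs)
    refine ⟨x', hx', fun j => ?_⟩
    rw [← h j]
    simp [Finset.mem_symmDiff, Set.mem_symmDiff]
  · simp [mul_comm]

/-! ### The errors `J` and `rho`, and the sample size -/

theorem J_eq_measureReal_symmDiff {n : ℕ} (P : Measure (EuclideanSpace ℝ (Fin n)))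
    (x' x : EuclideanSpace ℝ (Fin n)) :
    J P x' x = P.real (symmDiff (halfSpace x) (halfSpace x')) := by
  have : ∀ a, |(halfSpace x).indicator (fun _ => (1 : ℝ)) a
      - (halfSpace x').indicator (fun _ => (1 : ℝ)) a|
      = (symmDiff (halfSpace x) (halfSpace x')).indicator 1 a := fun a => by
    by_cases h : a ∈ halfSpace x <;> by_cases h' : a ∈ halfSpace x' <;>
      simp [Set.mem_symmDiff, h, h', Set.indicator]
  rw [J, genError]
  simp_rw [this]
  rw [integral_indicator_one ((measurableSet_halfSpace x).symmDiff (measurableSet_halfSpace x'))]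

theorem J_le_one {n : ℕ} (P : Measure (EuclideanSpace ℝ (Fin n))) [IsProbabilityMeasure P]
    (x' x : EuclideanSpace ℝ (Fin n)) : J P x' x ≤ 1 := by
  rw [J_eq_measureReal_symmDiff]
  exact measureReal_le_one

theorem rho_eq_two_mul_J {n : ℕ} (P : Measure (EuclideanSpace ℝ (Fin n)))
    (x' x : EuclideanSpace ℝ (Fin n)) : rho P x' x = 2 * J P x' x := by
  rw [rho, J, genError, ← integral_const_mul]
  congr 1
  ext a
  by_cases h : 0 ≤ inner ℝ a x <;> by_cases h' : 0 ≤ inner ℝ a x' <;>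
    norm_num [sgn, halfSpace, Set.indicator, h, h']

theorem sgn_eq_iff {s t : ℝ} : sgn s = sgn t ↔ (0 ≤ s ↔ 0 ≤ t) := by
  by_cases hs : 0 ≤ s <;> by_cases ht : 0 ≤ t <;> simp [sgn, hs, ht]

theorem Recovery.IsConsistent.notMem_symmDiff {n k : ℕ} {A : Recovery n} (hA : A.IsConsistent k)
    {x : EuclideanSpace ℝ (Fin n)} (hx : x ∈ sparse n k) {m : ℕ}
    (a : Fin m → EuclideanSpace ℝ (Fin n)) (i : Fin m) :
    a i ∉ symmDiff (halfSpace x) (halfSpace (A m (measure x a))) := by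
  have := sgn_eq_iff.1 (hA x hx m a i)
  simp only [Set.mem_symmDiff, halfSpace, mem_ofPred_eq]
  tauto

/-- The sample size is large enough for the growth function. -/
theorem growth_le_of_sampleSize {n k d m : ℕ} (hn : 1 ≤ n) (hk : 1 ≤ k) {ε δ : ℝ} (hε : 0 < ε)
    (hε1 : ε < 1) (hδ : 0 < δ)
    (hd : d = ⌊2 * (k : ℝ) * Real.logb 2 ((n : ℝ) * Real.exp 1)⌋₊)
    (hm₁ : 8 * (d : ℝ) / ε * Real.logb 2 (8 * Real.exp 1 / ε) ≤ m)
    (hm₂ : 4 / ε * Real.logb 2 (2 / δ) ≤ m) :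
    8 ≤ ε * m ∧
      2 * ((n ^ k * ∑ j ∈ Finset.Iic k, (2 * m).choose j : ℕ) : ℝ) / 2 ^ (ε * m / 2) ≤ δ := by
  have he : (2 : ℝ) < Real.exp 1 := by linarith [Real.exp_one_gt_d9]
  have hk1 : (1 : ℝ) ≤ k := by exact_mod_cast hk
  have hn1 : (1 : ℝ) ≤ n := by exact_mod_cast hn
  have hk0 : (0 : ℝ) < k := by linarith
  have hn0 : (0 : ℝ) < n := by linarith
  set L := Real.logb 2 (8 * Real.exp 1 / ε) with hL
  set l := Real.logb 2 ((n : ℝ) * Real.exp 1) with hl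
  have hu : 16 < 8 * Real.exp 1 / ε := by
    rw [lt_div_iff₀ hε]
    nlinarith
  have hL4 : 4 ≤ L := by
    rw [hL, Real.le_logb_iff_rpow_le one_lt_two (by linarith)]
    norm_num at hu ⊢
    exact hu.le
  have hl1 : 1 ≤ l := by
    rw [hl, Real.le_logb_iff_rpow_le one_lt_two (by positivity), Real.rpow_one]
    nlinarith
  have hln : Real.logb 2 n ≤ l := by
    refine Real.logb_le_logb_of_le one_lt_two hn0 ?_
    nlinarith
  have hkl : (k : ℝ) ≤ k * l := le_mul_of_one_le_right hk0.le hl1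
  have hd2 : 2 * (k : ℝ) ≤ d := by
    have : 2 * k ≤ d := by
      rw [hd]
      refine Nat.le_floor ?_
      push_cast
      linarith
    exact_mod_cast this
  -- The floor loses less than `1`, and `1 ≤ k * l`.
  have hdl : k * l ≤ d := by
    have := Nat.lt_floor_add_one (2 * (k : ℝ) * l)
    rw [← hd] at this
    linarith
  have hεm : 8 * d * L ≤ ε * m := by
    have := mul_le_mul_of_nonneg_left hm₁ hε.le
    calc 8 * d * L = ε * (8 * d / ε * L) := by field_simp
      _ ≤ ε * m := this
  have hdL : 4 * (d : ℝ) ≤ d * L := by nlinarith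
  have hεm8 : 8 ≤ ε * m := by linarith
  refine ⟨hεm8, ?_⟩
  -- In this scale `2 ^ (ε * m / 4)` is `(2 ^ z) ^ k`, so the growth bound reduces to its base. That
  -- base is `n * (8 e / ε) * z`, and each of the three factors is at most `2 ^ (z / 3)`.
  set z := ε * m / (4 * k) with hz
  have hzk : z * (4 * k) = ε * m := by
    rw [hz]
    field_simp
  have hz₁ : 4 * L ≤ z := by
    rw [hz, le_div_iff₀ (by positivity)]
    nlinarith
  have hz₂ : 8 * l ≤ z := by
    rw [hz, le_div_iff₀ (by positivity)]
    nlinarith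
  have hz0 : 16 ≤ z := by linarith
  have hkm : k ≤ 2 * m := by
    have : (k : ℝ) ≤ 2 * m := by nlinarith
    exact_mod_cast this
  have h₁ : 8 * Real.exp 1 / ε ≤ 2 ^ (z / 3) := by
    rw [← Real.logb_le_iff_le_rpow one_lt_two (by positivity)]
    linarith
  have h₂ : (n : ℝ) ≤ 2 ^ (z / 3) := by
    rw [← Real.logb_le_iff_le_rpow one_lt_two hn0]
    linarith
  have h₃ : z ≤ 2 ^ (z / 3) := by
    have hlog := Real.log_two_gt_d9
    -- Tangent line of `2 ^ (z / 3)` at `z = 12`, where the value is `16` and the slope exceeds `1`.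
    have hexp := Real.add_one_le_exp (Real.log 2 * (z / 3 - 4))
    rw [← Real.rpow_def_of_pos two_pos] at hexp
    have hsplit : (2 : ℝ) ^ (z / 3) = 16 * 2 ^ (z / 3 - 4) := by
      rw [Real.rpow_sub two_pos]
      norm_num
      ring
    rw [hsplit]
    nlinarith
  have hbase : n * (Real.exp 1 * (2 * m : ℕ) / k) ≤ 2 ^ z := by
    have hm' : (m : ℝ) = 4 * k * z / ε := by
      rw [hz]
      field_simp
    calc n * (Real.exp 1 * (2 * m : ℕ) / k) = n * (8 * Real.exp 1 / ε) * z := by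
          push_cast
          rw [hm']
          field_simp
          ring
      _ ≤ 2 ^ (z / 3) * 2 ^ (z / 3) * 2 ^ (z / 3) := by gcongr
      _ = 2 ^ z := by
          rw [← Real.rpow_add two_pos, ← Real.rpow_add two_pos]
          ring_nf
  have hG : ((n ^ k * ∑ j ∈ Finset.Iic k, (2 * m).choose j : ℕ) : ℝ) ≤ 2 ^ (ε * m / 4) := by
    rw [Nat.cast_mul, Nat.cast_pow]
    calc (n : ℝ) ^ k * ((∑ j ∈ Finset.Iic k, (2 * m).choose j : ℕ) : ℝ)
        ≤ n ^ k * (Real.exp 1 * (2 * m : ℕ) / k) ^ k := by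
          gcongr
          exact sum_choose_le_rpow hk hkm
      _ = (n * (Real.exp 1 * (2 * m : ℕ) / k)) ^ k := (mul_pow _ _ _).symm
      _ ≤ ((2 : ℝ) ^ z) ^ k := by gcongr
      _ = 2 ^ (ε * m / 4) := by
          rw [← Real.rpow_mul_natCast two_pos.le]
          congr 1
          linarith
  have hδ' : 2 ≤ 2 ^ (ε * m / 4) * δ := by
    rw [← div_le_iff₀ hδ, ← Real.logb_le_iff_le_rpow one_lt_two (by positivity),
      le_div_iff₀ (by norm_num)]
    have := mul_le_mul_of_nonneg_left hm₂ hε.le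
    calc Real.logb 2 (2 / δ) * 4 = ε * (4 / ε * Real.logb 2 (2 / δ)) := by field_simp
      _ ≤ ε * m := this
  have hsq : (2 : ℝ) ^ (ε * m / 2) = 2 ^ (ε * m / 4) * 2 ^ (ε * m / 4) := by
    rw [← Real.rpow_add two_pos]
    ring_nf
  rw [div_le_iff₀ (by positivity), hsq]
  have hpos : (0 : ℝ) < 2 ^ (ε * m / 4) := by positivity
  nlinarith

theorem eq_zero_of_mem_sparse_zero {n : ℕ} {x : EuclideanSpace ℝ (Fin n)} (hx : x ∈ sparse n 0) :
    x = 0 := by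
  have h : {i | x i ≠ 0} = ∅ := by
    rw [← Set.ncard_eq_zero]
    exact Nat.le_zero.1 hx
  ext i
  by_contra hi
  exact (h ▸ (show i ∈ {i | x i ≠ 0} from hi) : i ∈ (∅ : Set (Fin n)))

/-- The sample complexity of a consistent algorithm. -/
theorem measure_J_gt_le {n k : ℕ} (hn : 1 ≤ n) {A : Recovery n} (hsparse : A.IsSparse k)
    (hcons : A.IsConsistent k) (P : ProbabilityMeasure (EuclideanSpace ℝ (Fin n)))
    {x : EuclideanSpace ℝ (Fin n)} (hx : x ∈ sparse n k) {ε δ : ℝ} (hε : 0 < ε) (hδ : 0 < δ)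
    {d m : ℕ} (hd : d = ⌊2 * (k : ℝ) * Real.logb 2 ((n : ℝ) * Real.exp 1)⌋₊)
    (hm₁ : 8 * (d : ℝ) / ε * Real.logb 2 (8 * Real.exp 1 / ε) ≤ m)
    (hm₂ : 4 / ε * Real.logb 2 (2 / δ) ≤ m) :
    sampleLaw P m {a | ε < J (P : Measure _) (A m (measure x a)) x} ≤ ENNReal.ofReal δ := by
  rcases le_or_gt 1 ε with hε1 | hε1
  · have : {a | ε < J (P : Measure _) (A m (measure x a)) x} = ∅ :=
      Set.eq_empty_of_forall_notMem fun a ha =>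
        absurd (lt_of_lt_of_le ha (J_le_one _ _ _)) hε1.not_gt
    simp [this]
  -- For `k = 0` the growth bound would divide by `0`; but then both vectors vanish and the error is
  -- `0`.
  rcases Nat.eq_zero_or_pos k with rfl | hk
  · have : {a | ε < J (P : Measure _) (A m (measure x a)) x} = ∅ :=
      Set.eq_empty_of_forall_notMem fun a ha => by
        have ha' : ε < J (P : Measure _) (A m (measure x a)) x := ha
        rw [eq_zero_of_mem_sparse_zero hx, eq_zero_of_mem_sparse_zero (hsparse m _),
          J_eq_measureReal_symmDiff] at ha'
        simp at ha'
        exact ha'.not_gt hε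
    simp [this]
  obtain ⟨hεm, hbound⟩ := growth_le_of_sampleSize hn hk hε hε1 hδ hd hm₁ hm₂
  refine le_trans (measure_mono ?_) ((measure_exists_missed_le (P : Measure _)
    (𝒟 := errorRegions k x) ?_ (measurableSet_hasTrace_errorRegions x)
    (card_hasTrace_errorRegions_le hn x) hεm).trans (ENNReal.ofReal_le_ofReal hbound))
  · intro a ha
    refine ⟨_, mem_image_of_mem _ (hsparse m (measure x a)), hcons.notMem_symmDiff hx a, ?_⟩
    rw [← J_eq_measureReal_symmDiff]
    exact ha
  · rintro _ ⟨x', -, rfl⟩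
    exact (measurableSet_halfSpace x).symmDiff (measurableSet_halfSpace x')

theorem toAlgorithm_labelled {n k : ℕ} {A : Recovery n} (hA : A.IsSparse k)
    (x : EuclideanSpace ℝ (Fin n)) {m : ℕ} (c : Fin m → EuclideanSpace ℝ (Fin n)) :
    (A.toAlgorithm hA m (labelled (halfSpace x) c) : Set (EuclideanSpace ℝ (Fin n)))
      = halfSpace (A m (measure x c)) := by
  simp only [Recovery.toAlgorithm]
  congr 2
  ext1 i
  by_cases h : 0 ≤ inner ℝ (c i) x <;> simp [labelled, measure, halfSpace, sgn, h]

/-- The sample size in `measure_J_gt_le` depends on neither the law nor the target, so its bound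
passes to the suprema. -/
theorem Recovery.isPAC {n k : ℕ} (hn : 1 ≤ n) {A : Recovery n} (hsparse : A.IsSparse k)
    (hcons : A.IsConsistent k) : IsPAC Set.univ (A.toAlgorithm hsparse) := by
  intro ε hε
  rw [ENNReal.tendsto_nhds_zero]
  intro η hη
  obtain ⟨δ, hδ, hδη⟩ : ∃ δ : ℝ, 0 < δ ∧ ENNReal.ofReal δ ≤ η := by
    rcases eq_or_ne η ⊤ with rfl | hη'
    · exact ⟨1, one_pos, le_top⟩
    · exact ⟨η.toReal, ENNReal.toReal_pos hη.ne' hη', (ENNReal.ofReal_toReal hη').le⟩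
  filter_upwards [tendsto_natCast_atTop_atTop.eventually_ge_atTop
      (8 * (⌊2 * (k : ℝ) * Real.logb 2 ((n : ℝ) * Real.exp 1)⌋₊ : ℝ) / ε *
        Real.logb 2 (8 * Real.exp 1 / ε)),
    tendsto_natCast_atTop_atTop.eventually_ge_atTop (4 / ε * Real.logb 2 (2 / δ))] with m hm₁ hm₂
  refine le_trans ?_ hδη
  refine iSup₂_le fun P _ => iSup₂_le ?_
  rintro _ ⟨x, hx, rfl⟩
  simp_rw [toAlgorithm_labelled]
  exact measure_J_gt_le hn hsparse hcons P hx hε hδ rfl hm₁ hm₂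

/-! ### Radially invariant laws -/

/-- Additive nonnegative functions on an interval are at least linear. -/
theorem mul_le_mul_of_additive_on {f : ℝ → ℝ} {c : ℝ} (hc : 0 < c) (h0 : ∀ t, 0 ≤ f t)
    (hadd : ∀ s t, 0 ≤ s → 0 ≤ t → s + t ≤ c → f (s + t) = f s + f t) {θ : ℝ} (hθ : 0 ≤ θ)
    (hθc : θ ≤ c) : θ / c * f c ≤ f θ := by
  have hmono : ∀ s t, 0 ≤ s → s ≤ t → t ≤ c → f s ≤ f t := fun s t hs hst htc => by
    have := hadd s (t - s) hs (by linarith) (by linarith)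
    rw [add_sub_cancel] at this
    linarith [h0 (t - s)]
  have hzero : f 0 = 0 := by
    have := hadd 0 0 le_rfl le_rfl (by linarith)
    rw [add_zero] at this
    linarith
  have hmul : ∀ (t : ℝ), 0 ≤ t → ∀ j : ℕ, j * t ≤ c → f (j * t) = j * f t := by
    intro t ht j
    induction j with
    | zero => simp [hzero]
    | succ j ih =>
      intro hj
      push_cast at hj ⊢
      rw [add_mul, one_mul] at hj ⊢
      rw [hadd _ _ (by positivity) ht hj, ih (by linarith)]
      ring
  -- Compare `θ` with the multiple of `c / N` just below it. Monotonicity, a consequence of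
  -- nonnegativity, replaces continuity.
  have hN : ∀ N : ℕ, 0 < N → θ / c * f c - f c / N ≤ f θ := fun N hN => by
    have hN0 : (0 : ℝ) < N := by exact_mod_cast hN
    set j := ⌊θ / c * N⌋₊
    have hj : (j : ℝ) ≤ θ / c * N := Nat.floor_le (by positivity)
    have hj' : θ / c * N < j + 1 := Nat.lt_floor_add_one _
    have h₁ : f c = N * f (c / N) := by
      rw [← hmul (c / N) (by positivity) N (by field_simp; rfl)]
      congr 1
      field_simp
    have hjθ : j * (c / N) ≤ θ := by
      calc j * (c / N) ≤ θ / c * N * (c / N) := by gcongr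
        _ = θ := by field_simp
    have h₂ := hmul (c / N) (by positivity) j (hjθ.trans hθc)
    have h₃ := hmono _ _ (by positivity) hjθ hθc
    rw [h₂] at h₃
    have h₄ : f (c / N) = f c / N := by
      rw [h₁]
      field_simp
    rw [h₄] at h₃
    have h₅ : θ / c * f c - f c / N = (θ / c * N - 1) * (f c / N) := by field_simp
    rw [h₅]
    refine le_trans ?_ h₃
    have := h0 c
    gcongr
    linarith
  have hlim : Tendsto (fun N : ℕ => θ / c * f c - f c / N) atTop (𝓝 (θ / c * f c - 0)) :=
    tendsto_const_nhds.sub (tendsto_const_div_atTop_nhds_zero_nat _)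
  rw [sub_zero] at hlim
  exact le_of_tendsto hlim (eventually_atTop.2 ⟨1, fun N h => hN N h⟩)

/-- The unit vectors of a plane. -/
def planeVector {E : Type*} [AddCommGroup E] [Module ℝ E] (u v : E) (t : ℝ) : E :=
  Real.cos t • u + Real.sin t • v

section Plane

variable {n : ℕ} {u v : EuclideanSpace ℝ (Fin n)}

theorem inner_planeVector (hu : ‖u‖ = 1) (hv : ‖v‖ = 1) (huv : inner ℝ u v = 0) (s t : ℝ) :
    inner ℝ (planeVector u v s) (planeVector u v t) = Real.cos (s - t) := by
  have hvu : inner ℝ v u = 0 := by rw [real_inner_comm, huv]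
  simp [planeVector, inner_add_left, inner_add_right, real_inner_smul_left, real_inner_smul_right,
    huv, hvu, hu, hv, Real.cos_sub, mul_comm]

theorem reflection_planeVector (hu : ‖u‖ = 1) (hv : ‖v‖ = 1) (huv : inner ℝ u v = 0) (r s : ℝ) :
    (Submodule.span ℝ {planeVector u v r}).reflection (planeVector u v s)
      = planeVector u v (2 * r - s) := by
  have hnorm : ‖planeVector u v r‖ ^ 2 = 1 := by
    rw [← real_inner_self_eq_norm_sq, inner_planeVector hu hv huv]
    simp
  rw [Submodule.reflection_singleton_apply, inner_planeVector hu hv huv]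
  simp only [RCLike.ofReal_real_eq_id, id, hnorm, div_one]
  have h₁ : Real.cos (2 * r - s) = 2 * (Real.cos (r - s) * Real.cos r) - Real.cos s := by
    have := Real.cos_add (r - s) r
    have h' := Real.cos_sub (r - s) r
    rw [show r - s - r = -s by ring, Real.cos_neg] at h'
    rw [show 2 * r - s = r - s + r by ring]
    linarith
  have h₂ : Real.sin (2 * r - s) = 2 * (Real.cos (r - s) * Real.sin r) - Real.sin s := by
    have := Real.sin_add (r - s) r
    have h' := Real.sin_sub (r - s) r
    rw [show r - s - r = -s by ring, Real.sin_neg] at h'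
    rw [show 2 * r - s = r - s + r by ring]
    linarith
  simp only [planeVector]
  rw [h₁, h₂]
  module

/-- The volume of the part in the unit ball of the region where two vectors have different
signs. -/
def wedgeVolume (x y : EuclideanSpace ℝ (Fin n)) : ℝ :=
  (volume.restrict (Metric.ball (0 : EuclideanSpace ℝ (Fin n)) 1)).real
    (symmDiff (halfSpace x) (halfSpace y))

theorem wedgeVolume_comm (x y : EuclideanSpace ℝ (Fin n)) :
    wedgeVolume x y = wedgeVolume y x := by
  rw [wedgeVolume, symmDiff_comm, wedgeVolume]

/-- A reflection is a self-adjoint isometry: it pulls half-spaces back to half-spaces and preserves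
the volume and the ball. -/
theorem wedgeVolume_reflection (K : Submodule ℝ (EuclideanSpace ℝ (Fin n)))
    (x y : EuclideanSpace ℝ (Fin n)) :
    wedgeVolume (K.reflection x) (K.reflection y) = wedgeVolume x y := by
  have hH : ∀ x, halfSpace (K.reflection x) = K.reflection ⁻¹' halfSpace x := fun x => by
    ext a
    have : inner ℝ a (K.reflection x) = inner ℝ (K.reflection a) x := by
      rw [← K.reflection.inner_map_map a, Submodule.reflection_reflection]
    simp [halfSpace, this]
  have hR : MeasurePreserving K.reflection
      (volume.restrict (Metric.ball (0 : EuclideanSpace ℝ (Fin n)) 1))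
      (volume.restrict (Metric.ball (0 : EuclideanSpace ℝ (Fin n)) 1)) := by
    have := K.reflection.measurePreserving.restrict_preimage
      (s := Metric.ball (0 : EuclideanSpace ℝ (Fin n)) 1) measurableSet_ball
    rwa [K.reflection.preimage_ball, K.reflection.symm.map_zero] at this
  rw [wedgeVolume, hH, hH, wedgeVolume]
  exact hR.measureReal_preimage
    ((measurableSet_halfSpace x).symmDiff (measurableSet_halfSpace y)).nullMeasurableSet

theorem measure_inner_eq_zero (hu : u ≠ 0) :
    (volume.restrict (Metric.ball (0 : EuclideanSpace ℝ (Fin n)) 1)) {a | inner ℝ a u = 0} = 0 := by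
  refine le_antisymm ((Measure.restrict_le_self _).trans_eq ?_) zero_le
  have : {a | inner ℝ a u = 0} = ((Submodule.span ℝ {u})ᗮ : Set (EuclideanSpace ℝ (Fin n))) := by
    ext a
    simp [Submodule.mem_orthogonal_singleton_iff_inner_left]
  rw [this]
  refine Measure.addHaar_submodule _ _ fun h => hu ?_
  have : u ∈ (Submodule.span ℝ {u})ᗮ := h ▸ Submodule.mem_top
  rwa [Submodule.mem_orthogonal_singleton_iff_inner_left, inner_self_eq_zero] at this

theorem wedgeVolume_neg (hu : u ≠ 0) :
    wedgeVolume u (-u) = volume.real (Metric.ball (0 : EuclideanSpace ℝ (Fin n)) 1) := by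
  set ν := volume.restrict (Metric.ball (0 : EuclideanSpace ℝ (Fin n)) 1) with hν
  have : (symmDiff (halfSpace u) (halfSpace (-u)) : Set _) =ᵐ[ν] (univ : Set _) := by
    filter_upwards [measure_eq_zero_iff_ae_notMem.1 (measure_inner_eq_zero hu)] with a ha
    refine eq_true ?_ |>.trans (eq_true (mem_univ a)).symm
    change a ∈ symmDiff (halfSpace u) (halfSpace (-u))
    simp only [Set.mem_symmDiff, halfSpace, mem_ofPred_eq, inner_neg_right, not_le] at ha ⊢
    rcases lt_or_gt_of_ne ha with h | h
    · exact Or.inr ⟨by linarith, h⟩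
    · exact Or.inl ⟨h.le, by linarith⟩
  rw [wedgeVolume, measureReal_congr this, hν]
  simp

/-- As the angle runs over `[0, π]`, the sign of `⟨a, ·⟩` changes at most once unless `a` is
orthogonal to `u`. Hence the two partial wedges overlap only in a null set. -/
theorem wedgeVolume_add (hu : u ≠ 0) {s t : ℝ} (hs : 0 ≤ s) (hst : s ≤ t) (ht : t ≤ Real.pi) :
    wedgeVolume u (planeVector u v t)
      = wedgeVolume u (planeVector u v s) + wedgeVolume (planeVector u v s) (planeVector u v t) := by
  set A := symmDiff (halfSpace u) (halfSpace (planeVector u v s))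
  set B := symmDiff (halfSpace (planeVector u v s)) (halfSpace (planeVector u v t))
  have hAm : MeasurableSet A := (measurableSet_halfSpace _).symmDiff (measurableSet_halfSpace _)
  have hBm : MeasurableSet B := (measurableSet_halfSpace _).symmDiff (measurableSet_halfSpace _)
  have hAB : symmDiff (halfSpace u) (halfSpace (planeVector u v t)) = symmDiff A B := by
    rw [symmDiff_assoc, symmDiff_symmDiff_cancel_left]
  have hnull : A ∩ B ⊆ {a | inner ℝ a u = 0} := by
    rintro a ⟨hA, hB⟩
    by_contra hne
    simp only [A, B, Set.mem_symmDiff, halfSpace, planeVector, mem_ofPred_eq, inner_add_right,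
      real_inner_smul_right, not_le] at hA hB hne
    set p := inner ℝ a u
    set q := inner ℝ a v
    have hs1 := Real.sin_nonneg_of_nonneg_of_le_pi hs (hst.trans ht)
    have ht1 := Real.sin_nonneg_of_nonneg_of_le_pi (hs.trans hst) ht
    have hd1 := Real.sin_nonneg_of_nonneg_of_le_pi (sub_nonneg.2 hst) (by linarith)
    -- The middle vector, scaled by `sin t`, is a nonnegative combination of the outer two, so it
    -- cannot have the opposite sign to both; vanishing sines are treated apart.
    have hid : Real.sin t * (Real.cos s * p + Real.sin s * q)
        = Real.sin (t - s) * p + Real.sin s * (Real.cos t * p + Real.sin t * q) := by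
      rw [Real.sin_sub]
      ring
    rcases hA with ⟨h₁, h₂⟩ | ⟨h₁, h₂⟩ <;> rcases hB with ⟨h₃, h₄⟩ | ⟨h₃, h₄⟩ <;> try linarith
    · rcases ht1.eq_or_lt with h0 | h0
      · rcases (hs.trans hst).eq_or_lt with rfl | htpos
        · obtain rfl : s = 0 := le_antisymm hst hs
          linarith
        · have htpi : t = Real.pi := by
            by_contra hne'
            exact (Real.sin_pos_of_pos_of_lt_pi htpos (lt_of_le_of_ne ht hne')).ne h0
          rw [htpi, Real.cos_pi, Real.sin_pi] at h₃
          exact hne (by linarith)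
      · nlinarith
    · have h₅ : 0 ≤ Real.sin (t - s) * p + Real.sin s * (Real.cos t * p + Real.sin t * q) :=
        hid ▸ mul_nonneg ht1 h₁
      have h₆ := mul_nonneg hd1 (neg_pos.2 h₂).le
      have h₇ := mul_nonneg hs1 (neg_pos.2 h₄).le
      have h₈ : Real.sin (t - s) = 0 := by
        have : Real.sin (t - s) * p = 0 := by linarith
        exact (mul_eq_zero.1 this).resolve_right hne
      have h₉ : Real.sin s = 0 := by
        have : Real.sin s * (Real.cos t * p + Real.sin t * q) = 0 := by linarith
        exact (mul_eq_zero.1 this).resolve_right h₄.ne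
      have h₁₀ : Real.sin t = 0 := by
        have := Real.sin_add (t - s) s
        rw [sub_add_cancel, h₈, h₉] at this
        linarith
      rw [h₉] at h₁
      rw [h₁₀] at h₄
      have hcs : Real.cos (t - s) = Real.cos t * Real.cos s := by rw [Real.cos_sub, h₉]; ring
      rcases (sub_nonneg.2 hst).eq_or_lt with hts | hts
      · rw [show t = s by linarith] at h₄
        linarith
      · have hpi : t - s = Real.pi := by
          by_contra hne'
          exact (Real.sin_pos_of_pos_of_lt_pi hts (lt_of_le_of_ne (by linarith) hne')).ne' h₈
        obtain rfl : s = 0 := by linarith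
        rw [Real.cos_zero] at h₁
        linarith
  have hdisj : AEDisjoint (volume.restrict (Metric.ball 0 1)) A B :=
    measure_mono_null hnull (measure_inner_eq_zero hu)
  have hae : (symmDiff A B : Set _) =ᵐ[volume.restrict (Metric.ball 0 1)] (A ∪ B : Set _) := by
    filter_upwards [measure_eq_zero_iff_ae_notMem.1 hdisj] with a ha
    refine propext ?_
    change a ∈ symmDiff A B ↔ a ∈ A ∪ B
    simp only [Set.mem_symmDiff, mem_union, mem_inter_iff] at ha ⊢
    tauto
  have : IsFiniteMeasure (volume.restrict (Metric.ball (0 : EuclideanSpace ℝ (Fin n)) 1)) :=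
    ⟨by simpa using measure_ball_lt_top⟩
  rw [wedgeVolume, hAB, measureReal_congr hae, measureReal_union₀ hBm.nullMeasurableSet hdisj]
  rfl

/-- Rotation invariance from a single reflection: the one in the line at angle `t / 2` sends `t` to
`0` and `s` to `t - s`. -/
theorem wedgeVolume_planeVector (hu : ‖u‖ = 1) (hv : ‖v‖ = 1) (huv : inner ℝ u v = 0) (s t : ℝ) :
    wedgeVolume (planeVector u v s) (planeVector u v t)
      = wedgeVolume u (planeVector u v (t - s)) := by
  have h₁ := reflection_planeVector hu hv huv (t / 2) s
  have h₂ := reflection_planeVector hu hv huv (t / 2) t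
  rw [show 2 * (t / 2) - s = t - s by ring] at h₁
  rw [show 2 * (t / 2) - t = 0 by ring] at h₂
  rw [← wedgeVolume_reflection (Submodule.span ℝ {planeVector u v (t / 2)}), h₁, h₂,
    wedgeVolume_comm]
  simp [planeVector]

theorem mul_le_wedgeVolume_planeVector (hu : ‖u‖ = 1) (hv : ‖v‖ = 1) (huv : inner ℝ u v = 0)
    {θ : ℝ} (hθ : 0 ≤ θ) (hθπ : θ ≤ Real.pi) :
    θ / Real.pi * volume.real (Metric.ball (0 : EuclideanSpace ℝ (Fin n)) 1)
      ≤ wedgeVolume u (planeVector u v θ) := by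
  have hu0 : u ≠ 0 := norm_ne_zero_iff.1 (by simp [hu])
  have hπ : planeVector u v Real.pi = -u := by simp [planeVector]
  rw [← wedgeVolume_neg hu0, ← hπ]
  refine mul_le_mul_of_additive_on (f := fun t => wedgeVolume u (planeVector u v t)) Real.pi_pos
    (fun t => measureReal_nonneg) (fun s t hs ht hst => ?_) hθ hθπ
  have := wedgeVolume_add (v := v) hu0 hs (le_add_of_nonneg_right ht) hst
  rwa [wedgeVolume_planeVector hu hv huv s (s + t), add_sub_cancel_left] at this

end Plane

theorem angle_mul_le_wedgeVolume {n : ℕ} {x y : EuclideanSpace ℝ (Fin n)} (hx : ‖x‖ = 1)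
    (hy : ‖y‖ = 1) :
    InnerProductGeometry.angle x y / Real.pi *
      volume.real (Metric.ball (0 : EuclideanSpace ℝ (Fin n)) 1) ≤ wedgeVolume x y := by
  set θ := InnerProductGeometry.angle x y with hθ
  have hx0 : x ≠ 0 := norm_ne_zero_iff.1 (by simp [hx])
  have hcos : inner ℝ x y = Real.cos θ := by
    rw [hθ, InnerProductGeometry.cos_angle, hx, hy]
    simp
  have hθ0 : 0 ≤ θ := InnerProductGeometry.angle_nonneg x y
  have hθπ : θ ≤ Real.pi := InnerProductGeometry.angle_le_pi x y
  -- At angles `0` and `π` the vectors are parallel and span no plane; otherwise Gram–Schmidt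
  -- supplies the second axis.
  rcases hθ0.eq_or_lt with h0 | h0
  · rw [← h0]
    rw [zero_div, zero_mul]
    exact measureReal_nonneg
  rcases hθπ.eq_or_lt with hπ | hπ
  · obtain ⟨-, r, hr, hyr⟩ := InnerProductGeometry.angle_eq_pi_iff.1 (hθ ▸ hπ)
    have hr1 : r = -1 := by
      have : ‖r • x‖ = 1 := hyr ▸ hy
      rw [norm_smul, hx, mul_one, Real.norm_eq_abs, abs_of_neg hr] at this
      linarith
    rw [hr1, neg_one_smul] at hyr
    rw [hyr, wedgeVolume_neg hx0, hπ, div_self Real.pi_ne_zero, one_mul]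
  · have hsin := Real.sin_pos_of_pos_of_lt_pi h0 hπ
    set v := (Real.sin θ)⁻¹ • (y - Real.cos θ • x) with hv
    have hyv : planeVector x v θ = y := by
      rw [planeVector, hv, smul_inv_smul₀ hsin.ne']
      module
    have hxv : inner ℝ x v = 0 := by
      rw [hv, real_inner_smul_right, inner_sub_right, hcos, real_inner_smul_right,
        real_inner_self_eq_norm_sq, hx]
      ring
    have hsq : ‖y - Real.cos θ • x‖ ^ 2 = Real.sin θ ^ 2 := by
      rw [norm_sub_sq_real, real_inner_smul_right, real_inner_comm, hcos, norm_smul, hx, hy,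
        Real.norm_eq_abs, mul_one, sq_abs, Real.sin_sq]
      ring
    have hnv : ‖v‖ = 1 := by
      rw [hv, norm_smul, (pow_left_inj₀ (norm_nonneg _) hsin.le two_ne_zero).1 hsq, norm_inv,
        Real.norm_of_nonneg hsin.le, inv_mul_cancel₀ hsin.ne']
    have := mul_le_wedgeVolume_planeVector hx hnv hxv hθ0 hθπ
    rwa [hyv] at this

/-! ### Cones under radially invariant laws -/

open scoped Pointwise in
/-- A radially invariant law gives to a cone its proportion of the unit ball. -/
theorem IsRadiallyInvariant.measure_cone {n : ℕ} (hn : 1 ≤ n)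
    {P : Measure (EuclideanSpace ℝ (Fin n))} (hP : IsRadiallyInvariant P)
    {S : Set (EuclideanSpace ℝ (Fin n))} (hS : MeasurableSet S)
    (hcone : ∀ c : ℝ, 0 < c → ∀ a, c • a ∈ S ↔ a ∈ S) :
    P.real S = (volume.restrict (Metric.ball (0 : EuclideanSpace ℝ (Fin n)) 1)).real S /
      volume.real (Metric.ball (0 : EuclideanSpace ℝ (Fin n)) 1) := by
  have : Nonempty (Fin n) := ⟨⟨0, hn⟩⟩
  have hmeas : Measurable fun a : EuclideanSpace ℝ (Fin n) => ‖a‖⁻¹ • a := by fun_prop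
  have hpre : (fun a : EuclideanSpace ℝ (Fin n) => ‖a‖⁻¹ • a) ⁻¹' S = S := by
    ext a
    rcases eq_or_ne a 0 with rfl | ha
    · simp
    · exact hcone _ (inv_pos.2 (norm_pos_iff.2 ha)) a
  have h₁ : P S = sphereUniform n S := by
    rw [← hP, Measure.map_apply hmeas hS, hpre]
  -- The surface measure of a part of the sphere is `n` times the volume of the cone over it. The
  -- factor `n` cancels in the normalization.
  have hset : Ioo (0 : ℝ) 1 • (Subtype.val '' (Subtype.val ⁻¹' S :
      Set (Metric.sphere (0 : EuclideanSpace ℝ (Fin n)) 1)))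
      = (S ∩ Metric.ball 0 1) \ {0} := by
    ext a
    simp only [Subtype.image_preimage_coe, Set.mem_smul, mem_inter_iff, mem_sphere_zero_iff_norm,
      Set.mem_sdiff, mem_ball_zero_iff, mem_singleton_iff]
    constructor
    · rintro ⟨c, ⟨hc0, hc1⟩, b, ⟨hb, hbS⟩, rfl⟩
      have hb0 : b ≠ 0 := norm_ne_zero_iff.1 (by simp [hb])
      refine ⟨⟨(hcone c hc0 b).2 hbS, ?_⟩, smul_ne_zero hc0.ne' hb0⟩
      rwa [norm_smul, hb, mul_one, Real.norm_of_nonneg hc0.le]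
    · rintro ⟨⟨haS, ha1⟩, ha0⟩
      have hna := norm_pos_iff.2 ha0
      refine ⟨‖a‖, ⟨hna, ha1⟩, ‖a‖⁻¹ • a, ⟨?_, (hcone _ (inv_pos.2 hna) a).2 haS⟩,
        smul_inv_smul₀ hna.ne' a⟩
      rw [norm_smul, norm_inv, norm_norm, inv_mul_cancel₀ hna.ne']
  have h₂ : (volume : Measure (EuclideanSpace ℝ (Fin n))).toSphere (Subtype.val ⁻¹' S)
      = n * volume (S ∩ Metric.ball 0 1) := by
    rw [Measure.toSphere_apply' _ (measurable_subtype_coe hS), hset,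
      measure_sdiff_null (measure_singleton _)]
    simp
  have h₃ : (volume : Measure (EuclideanSpace ℝ (Fin n))).toSphere univ
      = n * volume (Metric.ball (0 : EuclideanSpace ℝ (Fin n)) 1) := by
    rw [Measure.toSphere_apply_univ]
    simp
  have hn0 : (n : ℝ) ≠ 0 := by
    have : n ≠ 0 := by omega
    exact_mod_cast this
  rw [measureReal_def, h₁, sphereUniform, Measure.map_apply measurable_subtype_coe hS,
    Measure.smul_apply, h₂, h₃, measureReal_def, Measure.restrict_apply hS, measureReal_def]
  simp only [smul_eq_mul, ENNReal.toReal_mul, ENNReal.toReal_inv, ENNReal.toReal_natCast]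
  field_simp

theorem IsRadiallyInvariant.angle_div_pi_le_J {n : ℕ} (hn : 1 ≤ n)
    {P : Measure (EuclideanSpace ℝ (Fin n))} (hP : IsRadiallyInvariant P)
    {x x' : EuclideanSpace ℝ (Fin n)} (hx : ‖x‖ = 1) (hx' : ‖x'‖ = 1) :
    InnerProductGeometry.angle x x' / Real.pi ≤ J P x' x := by
  have : Nonempty (Fin n) := ⟨⟨0, hn⟩⟩
  rw [J_eq_measureReal_symmDiff, hP.measure_cone hn
    ((measurableSet_halfSpace x).symmDiff (measurableSet_halfSpace x')) fun c hc a => by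
      simp only [Set.mem_symmDiff, halfSpace, mem_ofPred_eq, real_inner_smul_left,
        mul_nonneg_iff_of_pos_left hc]]
  have hball : 0 < volume.real (Metric.ball (0 : EuclideanSpace ℝ (Fin n)) 1) :=
    ENNReal.toReal_pos (Metric.measure_ball_pos _ _ one_pos).ne' measure_ball_lt_top.ne
  rw [le_div_iff₀ hball]
  exact angle_mul_le_wedgeVolume hx hx'

/-! ### The constant `alpha` and the chord -/

theorem one_sub_cos_pos {θ : ℝ} (h0 : 0 < θ) (h2 : θ < 2 * Real.pi) : 0 < 1 - Real.cos θ := by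
  have hsin := Real.sin_pos_of_pos_of_lt_pi (show 0 < θ / 2 by linarith) (by linarith)
  have := Real.cos_sq' (θ / 2)
  have h := Real.cos_sq (θ / 2)
  rw [mul_div_cancel₀ θ two_ne_zero] at h
  nlinarith

theorem alpha_le {θ : ℝ} (h0 : 0 < θ) (h2 : θ < 2 * Real.pi) :
    alpha ≤ 2 / Real.pi * (θ / (1 - Real.cos θ)) := by
  refine csInf_le ⟨0, ?_⟩ ⟨θ, ⟨h0, h2⟩, rfl⟩
  rintro _ ⟨t, ⟨ht0, ht2⟩, rfl⟩
  have := one_sub_cos_pos ht0 ht2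
  have := Real.pi_pos
  positivity

/-- The bound `2 / π` comes from `1 - cos t ≤ t`: use `1 - cos t ≤ 2` for `t ≥ 2` and `1 - cos t ≤ t
^ 2 / 2` below. -/
theorem alpha_pos : 0 < alpha := by
  have hpi := Real.pi_pos
  refine lt_of_lt_of_le (show 0 < 2 / Real.pi by positivity) (le_csInf ?_ ?_)
  · exact (nonempty_Ioo.2 (by positivity)).image _
  · rintro _ ⟨t, ⟨ht0, ht2⟩, rfl⟩
    refine le_mul_of_one_le_right (by positivity) ?_
    rw [one_le_div (one_sub_cos_pos ht0 ht2)]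
    rcases le_or_gt 2 t with h | h
    · linarith [Real.neg_one_le_cos t]
    · nlinarith [Real.one_sub_sq_div_two_le_cos (x := t)]

/-- The squared chord is `2 (1 - cos θ)`, at most `(4 / alpha) (θ / π)` by the choice of `alpha`,
and `θ / π ≤ J`. -/
theorem IsRadiallyInvariant.norm_sub_sq_le {n : ℕ} (hn : 1 ≤ n)
    {P : Measure (EuclideanSpace ℝ (Fin n))} (hP : IsRadiallyInvariant P)
    {x x' : EuclideanSpace ℝ (Fin n)} (hx : ‖x‖ = 1) (hx' : ‖x'‖ = 1) :
    ‖x' - x‖ ^ 2 ≤ 4 / alpha * J P x' x := by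
  set θ := InnerProductGeometry.angle x x' with hθ
  have hJ : θ / Real.pi ≤ J P x' x := hP.angle_div_pi_le_J hn hx hx'
  have hcos : inner ℝ x' x = Real.cos θ := by
    rw [hθ, InnerProductGeometry.cos_angle, hx, hx', real_inner_comm]
    simp
  have hθ0 : 0 ≤ θ := InnerProductGeometry.angle_nonneg x x'
  have hpi := Real.pi_pos
  have hθ2 : θ < 2 * Real.pi := by linarith [InnerProductGeometry.angle_le_pi x x']
  have hα := alpha_pos
  have hkey : alpha * (1 - Real.cos θ) ≤ 2 * (θ / Real.pi) := by
    rcases hθ0.eq_or_lt with h | h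
    · simp [← h]
    · calc alpha * (1 - Real.cos θ)
          ≤ 2 / Real.pi * (θ / (1 - Real.cos θ)) * (1 - Real.cos θ) :=
            mul_le_mul_of_nonneg_right (alpha_le h hθ2) (one_sub_cos_pos h hθ2).le
        _ = 2 * (θ / Real.pi) := by
            have := (one_sub_cos_pos h hθ2).ne'
            field_simp
  rw [norm_sub_sq_real, hcos, hx, hx', div_mul_eq_mul_div, le_div_iff₀ hα]
  nlinarith

end OneBit

end

theorem mainTheorem5 (n k : ℕ) (hn : 1 ≤ n) (A : OneBit.Recovery n)
    (hsparse : A.IsSparse k) (hcons : A.IsConsistent k) :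
    OneBit.IsPAC Set.univ (A.toAlgorithm hsparse) ∧
    ∀ (P : ProbabilityMeasure (EuclideanSpace ℝ (Fin n))) (x : EuclideanSpace ℝ (Fin n)),
      x ∈ OneBit.sparse n k →
      ∀ (ε δ : ℝ), 0 < ε → 0 < δ →
      ∀ (d m : ℕ), d = ⌊2 * (k : ℝ) * Real.logb 2 ((n : ℝ) * Real.exp 1)⌋₊ →
        max (8 * (d : ℝ) / ε * Real.logb 2 (8 * Real.exp 1 / ε)) (4 / ε * Real.logb 2 (2 / δ))
          ≤ (m : ℝ) →
        OneBit.sampleLaw P m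
            {a | ¬ (OneBit.J (P : Measure _) (A m (OneBit.measure x a)) x ≤ ε ∧
              OneBit.rho (P : Measure _) (A m (OneBit.measure x a)) x ≤ 2 * ε)}
          ≤ ENNReal.ofReal δ ∧
        (OneBit.IsRadiallyInvariant (P : Measure (EuclideanSpace ℝ (Fin n))) → ‖x‖ = 1 →
          OneBit.sampleLaw P m
              {a | ¬ (‖A m (OneBit.measure x a)‖ = 1 →
                ‖A m (OneBit.measure x a) - x‖ ^ 2 ≤ 4 / OneBit.alpha * ε)}
            ≤ ENNReal.ofReal δ) := by
  refine ⟨OneBit.Recovery.isPAC hn hsparse hcons, fun P x hx ε δ hε hδ d m hd hm => ?_⟩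
  have hJ := OneBit.measure_J_gt_le hn hsparse hcons P hx hε hδ hd
    ((le_max_left _ _).trans hm) ((le_max_right _ _).trans hm)
  -- Both failure events lie in the event that `J` exceeds `ε`, so one exceptional set serves for
  -- all the bounds.
  refine ⟨(measure_mono fun a ha => ?_).trans hJ,
    fun hP hx1 => (measure_mono fun a ha => ?_).trans hJ⟩
  · by_contra h
    have h' : OneBit.J (P : Measure _) (A m (OneBit.measure x a)) x ≤ ε := not_lt.1 h
    exact ha ⟨h', by rw [OneBit.rho_eq_two_mul_J]; linarith⟩
  · by_contra h
    have h' : OneBit.J (P : Measure _) (A m (OneBit.measure x a)) x ≤ ε := not_lt.1 h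
    have hα := OneBit.alpha_pos
    exact ha fun h1 => (hP.norm_sub_sq_le hn hx1 h1).trans (by gcongr)
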